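/- Let $\Omega\subset\mathbb R^2$ be a bounded open set and let $S_1$ be an open set with $C^\infty$ boundary such that $\overline{S_1}\subset\Omega$. Let $\lambda>0$ and $a>0$, $a\neq 1$, and let $p$ be the step function with $p=1$ in $S_1$, $p=a$ in $\Omega\setminus\overline{S_1}$, and $p=\min(1,a)$ on $\partial S_1$ (the lower semicontinuous representative; the value on $\partial S_1$ matters only when $p$ is integrated against measures that charge $\partial S_1$). Let $\mathcal M(\Omega)$ be the space of bounded signed Radon measures on $\Omega$, let $H^1_0(\Omega)$ be the closure of $C_c^\infty(\Omega)$ in $H^1(\Omega)$, and let $H^1_1(\Omega)=\{f\in H^1(\Omega): f-1\in H^1_0(\Omega)\}$. Functions are real-valued and identified when equal a.e. in $\Omega$, and $-\mathrm{div}(\frac1p\nabla u)$ is understood in the sense of distributions on $\Omega$. Then the problem $$\min_{\substack{u\in H^1_0(\Omega)\\ -\mathrm{div}(\frac1p\nabla u)+u\in\mathcal M(\Omega)}}\ \frac1\lambda\int_\Omega p\,d\Big|-\mathrm{div}\Big(\frac1p\nabla u\Big)+u+1\Big|+\int_\Omega\Big(\frac{|\nabla u|^2}{p}+|u|^2\Big)\,dx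 ,$$ where $|\nu|$ denotes the total variation of the measure $\nu$, has a unique minimizer $u_*$, and $u_*$ is also the unique minimizer of the dual problem $$\min_{\substack{v\in H^1_0(\Omega)\\ |v|\le \frac{p}{2\lambda}\ \text{a.e.}}}\ \int_\Omega\Big(\frac{|\nabla v|^2}{p}+|v|^2+2v\Big)\,dx .$$ Moreover $h_*=u_*+1$ minimizes $$\int_\Omega\Big(\frac{|\nabla f|^2}{p}+|f|^2\Big)\,dx$$ over all $f\in H^1_1(\Omega)$ with $f-1\ge-\frac{p}{2\lambda}$ a.e., and $-\mathrm{div}(\frac1p\nabla h_*)+h_*$ is a nonnegative measure in $\mathcal M(\Omega)$. -/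

import Mathlib

open MeasureTheory Set Filter Topology
open scoped ContDiff ENNReal Gradient

noncomputable section

/-- The Euclidean plane `ℝ²`. -/
abbrev Plane : Type := EuclideanSpace ℝ (Fin 2)

/-- `S` has a smooth boundary: near each boundary point, `S` is the negative set of a smooth
function whose gradient does not vanish at that point. -/
def HasSmoothBoundary (S : Set Plane) : Prop :=
  ∀ x ∈ frontier S, ∃ U ∈ 𝓝 x, ∃ ρ : Plane → ℝ,
    ContDiff ℝ ∞ ρ ∧ ∇ ρ x ≠ 0 ∧ ∀ y ∈ U, (y ∈ S ↔ ρ y < 0)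

/-- `φ ∈ C_c^∞(Ω)`. -/
structure IsTestFunction (Ω : Set Plane) (φ : Plane → ℝ) : Prop where
  smooth : ContDiff ℝ ∞ φ
  compact : HasCompactSupport φ
  support_subset : tsupport φ ⊆ Ω

/-- `G` is a square integrable weak gradient of `u` in `Ω`. -/
structure IsWeakGradient (Ω : Set Plane) (u : Plane → ℝ) (G : Plane → Plane) : Prop where
  memLp : MemLp G 2 (volume.restrict Ω)
  integral_eq : ∀ φ, IsTestFunction Ω φ →
    ∫ x in Ω, u x • ∇ φ x = -∫ x in Ω, φ x • G x

/-- `u ∈ H¹(Ω)`. -/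
structure MemH1 (Ω : Set Plane) (u : Plane → ℝ) : Prop where
  memLp : MemLp u 2 (volume.restrict Ω)
  exists_weakGradient : ∃ G, IsWeakGradient Ω u G

open Classical in
/-- The weak gradient of `u ∈ H¹(Ω)`, determined almost everywhere in `Ω`. -/
def weakGradient (Ω : Set Plane) (u : Plane → ℝ) : Plane → Plane :=
  if h : ∃ G, IsWeakGradient Ω u G then h.choose else 0

theorem MemH1.isWeakGradient {Ω : Set Plane} {u : Plane → ℝ} (hu : MemH1 Ω u) :
    IsWeakGradient Ω u (weakGradient Ω u) := by
  rw [weakGradient, dif_pos hu.exists_weakGradient]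
  exact hu.exists_weakGradient.choose_spec

/-- Weak gradients are unique almost everywhere. -/
theorem IsWeakGradient.ae_eq {Ω : Set Plane} (hΩ : IsOpen Ω) {u : Plane → ℝ} {G G' : Plane → Plane}
    (h : IsWeakGradient Ω u G) (h' : IsWeakGradient Ω u G') :
    G =ᵐ[volume.restrict Ω] G' := by
  have hL : LocallyIntegrable G (volume.restrict Ω) := h.memLp.locallyIntegrable (by norm_num)
  have hL' : LocallyIntegrable G' (volume.restrict Ω) := h'.memLp.locallyIntegrable (by norm_num)
  have hloc : ∀ {F : Plane → Plane}, LocallyIntegrable F (volume.restrict Ω) →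
      LocallyIntegrableOn F Ω volume := fun {F} hF x hx => by
    obtain ⟨U, hU, hFU⟩ := hF x
    refine ⟨U ∩ Ω, inter_mem (mem_nhdsWithin_of_mem_nhds hU) self_mem_nhdsWithin, ?_⟩
    rw [IntegrableOn, Measure.restrict_restrict_of_subset inter_subset_right |>.symm]
    exact hFU.mono_set inter_subset_left
  have key := hΩ.ae_eq_zero_of_integral_contDiff_smul_eq_zero
    ((hloc hL).sub (hloc hL')) (μ := (volume : Measure Plane)) (fun g g1 g2 g3 => by
      have e := h.integral_eq g ⟨g1, g2, g3⟩
      have e' := h'.integral_eq g ⟨g1, g2, g3⟩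
      have i : IntegrableOn (fun x => g x • G x) Ω :=
        hL.integrable_smul_left_of_hasCompactSupport g1.continuous g2
      have i' : IntegrableOn (fun x => g x • G' x) Ω :=
        hL'.integrable_smul_left_of_hasCompactSupport g1.continuous g2
      rw [← setIntegral_eq_integral_of_forall_compl_eq_zero (s := Ω)]
      · simp only [Pi.sub_apply, smul_sub]
        rw [integral_sub i i', sub_eq_zero, ← neg_inj, ← e, ← e']
      · intro x hx
        rw [image_eq_zero_of_notMem_tsupport (fun h => hx (g3 h)), zero_smul])
  rw [EventuallyEq, ae_restrict_iff' hΩ.measurableSet]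
  filter_upwards [key] with x hx hxΩ
  exact sub_eq_zero.1 (hx hxΩ)

/-- `u ∈ H¹₀(Ω)`: `u` is the limit in `H¹(Ω)` of functions of class `C_c^∞(Ω)`. -/
structure MemH10 (Ω : Set Plane) (u : Plane → ℝ) : Prop where
  memH1 : MemH1 Ω u
  exists_approx : ∃ φ : ℕ → Plane → ℝ, (∀ n, IsTestFunction Ω (φ n)) ∧
    Tendsto (fun n => eLpNorm (φ n - u) 2 (volume.restrict Ω)) atTop (𝓝 0) ∧
    Tendsto (fun n => eLpNorm (∇ (φ n) - weakGradient Ω u) 2 (volume.restrict Ω)) atTop (𝓝 0)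

/-- `f ∈ H¹₁(Ω)`: `f` is a Sobolev function with `f - 1 ∈ H¹₀(Ω)`. -/
structure MemH11 (Ω : Set Plane) (f : Plane → ℝ) : Prop where
  memH1 : MemH1 Ω f
  sub_one_memH10 : MemH10 Ω (fun x => f x - 1)

open Classical in
/-- The step function `p`, equal to `1` in `S₁` and to `a` off `closure S₁`. On the interface
`∂S₁` it takes the smaller of the two values, which makes it lower semicontinuous; that value
matters only for measures that charge `∂S₁`. -/
def stepWeight (S₁ : Set Plane) (a : ℝ) (x : Plane) : ℝ :=
  if x ∈ S₁ then 1 else if x ∈ frontier S₁ then min 1 a else a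

/-- The energy `∫_Ω (|∇u|² / p + |u|²)`. -/
def dirichletEnergy (Ω : Set Plane) (p u : Plane → ℝ) : ℝ :=
  ∫ x in Ω, (‖weakGradient Ω u x‖ ^ 2 / p x + |u x| ^ 2)

/-- The distribution `-div (∇u / p) + u + c` on `Ω`, for `u ∈ H¹(Ω)` and a constant `c`,
evaluated at the test function `φ`. -/
def operatorPairing (Ω : Set Plane) (p u : Plane → ℝ) (c : ℝ) (φ : Plane → ℝ) : ℝ :=
  ∫ x in Ω, (inner ℝ (weakGradient Ω u x) (∇ φ x) / p x + (u x + c) * φ x)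

/-- The integral of `f` against a finite signed measure `ν = ν₊ - ν₋`. -/
def signedIntegral {X : Type*} [MeasurableSpace X] (ν : SignedMeasure X) (f : X → ℝ) : ℝ :=
  (∫ x, f x ∂ν.toJordanDecomposition.posPart) - ∫ x, f x ∂ν.toJordanDecomposition.negPart

/-- `-div (∇u / p) + u + c = ν` in the sense of distributions on `Ω`, where `ν` is a finite signed
Borel (that is, bounded Radon) measure on `Ω`. -/
def IsOperatorMeasure (Ω : Set Plane) (p u : Plane → ℝ) (c : ℝ) (ν : SignedMeasure Ω) : Prop :=
  ∀ φ, IsTestFunction Ω φ → operatorPairing Ω p u c φ = signedIntegral ν (fun x : Ω => φ x)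

open Classical in
/-- The measure `-div (∇u / p) + u + c` on `Ω` (zero if that distribution is not a bounded Radon
measure). -/
def operatorMeasure (Ω : Set Plane) (p u : Plane → ℝ) (c : ℝ) : SignedMeasure Ω :=
  if h : ∃ ν, IsOperatorMeasure Ω p u c ν then h.choose else 0

/-- All `u ∈ H¹₀(Ω)` such that `-div (∇u / p) + u` is a bounded Radon measure. -/
def primalSet (Ω : Set Plane) (p : Plane → ℝ) : Set (Plane → ℝ) :=
  {u | MemH10 Ω u ∧ ∃ ν, IsOperatorMeasure Ω p u 0 ν}

/-- `∫_Ω (p / lam) |-div (∇u / p) + u + 1| + ∫_Ω (|∇u|² / p + |u|²)`, the first integral being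
with respect to the total variation of the measure. -/
def primalEnergy (Ω : Set Plane) (p : Plane → ℝ) (lam : ℝ) (u : Plane → ℝ) : ℝ :=
  (∫ x : Ω, p x / lam ∂(operatorMeasure Ω p u 1).totalVariation) + dirichletEnergy Ω p u

/-- All `v ∈ H¹₀(Ω)` with `|v| ≤ p / (2 lam)`. -/
def dualSet (Ω : Set Plane) (p : Plane → ℝ) (lam : ℝ) : Set (Plane → ℝ) :=
  {v | MemH10 Ω v ∧ ∀ᵐ x ∂volume.restrict Ω, |v x| ≤ p x / (2 * lam)}

/-- `∫_Ω (|∇v|² / p + |v|² + 2 v)`. -/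
def dualEnergy (Ω : Set Plane) (p v : Plane → ℝ) : ℝ :=
  ∫ x in Ω, (‖weakGradient Ω v x‖ ^ 2 / p x + |v x| ^ 2 + 2 * v x)

/-- All `f ∈ H¹₁(Ω)` with `f - 1 ≥ -p / (2 lam)`. -/
def obstacleSet (Ω : Set Plane) (p : Plane → ℝ) (lam : ℝ) : Set (Plane → ℝ) :=
  {f | MemH11 Ω f ∧ ∀ᵐ x ∂volume.restrict Ω, f x - 1 ≥ -(p x / (2 * lam))}

/-- `u` minimizes `J` over `A`. -/
def IsMinimizer (A : Set (Plane → ℝ)) (J : (Plane → ℝ) → ℝ) (u : Plane → ℝ) : Prop :=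
  u ∈ A ∧ IsMinOn J A u

/-- `u` is, up to equality almost everywhere in `Ω`, the only minimizer of `J` over `A`. -/
def IsUniqueMinimizer (Ω : Set Plane) (A : Set (Plane → ℝ)) (J : (Plane → ℝ) → ℝ)
    (u : Plane → ℝ) : Prop :=
  IsMinimizer A J u ∧ ∀ w, IsMinimizer A J w → w =ᵐ[volume.restrict Ω] u

end

/-! The pairs (u, ∇u) with u in H¹₀(Ω), extended by zero, form a closed subspace `zeroTraceJets Ω`
of the Hilbert space L²(ℝ²; ℝ × ℝ²). Let T multiply the gradient by p^(-1/2), let 1 stand for the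
pair (1_Ω, 0), and put q = p/(2λ). The Dirichlet energy of x is ‖Tx‖² and that of x + 1 is ‖Tx +
1‖²; completing the square, the dual energy is ‖Tx + 1‖² − |Ω|. So the dual problem and the obstacle
problem minimize the same strictly convex functional, under |x| ≤ q and under x ≥ −q respectively.
Projection solves the obstacle problem, with ⟨Tx + 1, T(y − x)⟩ ≥ 0 for every admissible y. Since
min(x, 0) is at least as good a competitor, x ≤ 0; hence |x| ≤ q and x also solves the dual problem.

Testing the inequality with y = x + φ, φ ≥ 0, shows that −div(∇x/p) + x + 1 is a positive
distribution. Testing it with y = −φ, φ ≤ q, shows that this distribution is a finite measure m with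
∫ q dm ≤ −⟨Tx + 1, Tx⟩. Hence the primal energy 2∫ q dm + ‖Tx‖² of x is at most −‖Tx‖² − 2⟨1, x⟩.
Conversely, let y be primal admissible, with measure ν = −div(∇y/p) + y + 1. Pairing ν with −x,
where |x| ≤ q, bounds the primal energy of y below by ‖T(y − x)‖² − ‖Tx‖² − 2⟨1, x⟩
(`le_primalEnergy`). This gives minimality and uniqueness at once.

The delicate point is that pairing: ν may charge null sets, in particular ∂S₁, while x is defined
only almost everywhere. So x has to be a limit in H¹ of test functions bounded by q at every point
(`exists_seq_testFunction_le`). Write p = b + c·1_U with U open, which is possible because p is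
lower semicontinuous. The truncation of x at height b/(2λ) leaves a remainder that vanishes off U.
As the boundary of U is regular, small inward translations show that the remainder lies in H¹₀(Ω ∩
U) (`mem_zeroTraceJets_inter`). Each of the two parts obeys a constant bound, and test functions
with the same bound approximate it, by composition with smooth contractions and a weak limit
(`exists_comp_mem_zeroTraceJets`). -/

noncomputable section

/-! ### Closed convex sets in Hilbert space -/

/-- In a Hilbert space, a decreasing sequence of closed convex sets, each of which meets a fixed
ball, has a common point. -/
theorem nonempty_iInter_of_closed_convex {H : Type*} [NormedAddCommGroup H]
    [InnerProductSpace ℝ H] [CompleteSpace H] (C : ℕ → Set H) (hcl : ∀ n, IsClosed (C n))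
    (hconv : ∀ n, Convex ℝ (C n)) (hanti : Antitone C) (R : ℝ)
    (hR : ∀ n, ∃ x ∈ C n, ‖x‖ ≤ R) : (⋂ n, C n).Nonempty := by
  have hne : ∀ n, (C n).Nonempty := fun n => let ⟨x, hx, _⟩ := hR n; ⟨x, hx⟩
  have hex : ∀ n, ∃ v ∈ C n, ∀ w ∈ C n, ‖v‖ ^ 2 ≤ inner ℝ v w := by
    intro n
    obtain ⟨v, hv, e⟩ := exists_norm_eq_iInf_of_complete_convex (hne n) (hcl n).isComplete
      (hconv n) 0
    refine ⟨v, hv, fun w hw => ?_⟩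
    have h := (norm_eq_iInf_iff_real_inner_le_zero (hconv n) hv).1 e w hw
    rw [zero_sub, inner_neg_left, inner_sub_right, real_inner_self_eq_norm_sq] at h
    linarith
  choose m hm hmin using hex
  have hle : ∀ n, ‖m n‖ ^ 2 ≤ R ^ 2 := by
    intro n
    obtain ⟨x, hx, hxR⟩ := hR n
    have h1 := (hmin n x hx).trans (real_inner_le_norm _ _)
    have h2 : ‖m n‖ ≤ ‖x‖ := by
      by_contra hlt
      push Not at hlt
      nlinarith [norm_nonneg x]
    exact pow_le_pow_left₀ (norm_nonneg _) (h2.trans hxR) 2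
  -- The least norms increase along the decreasing sets and stay below R, so this estimate makes the
  -- points of least norm a Cauchy sequence.
  have hdist : ∀ n k, n ≤ k → ‖m k - m n‖ ^ 2 ≤ ‖m k‖ ^ 2 - ‖m n‖ ^ 2 := by
    intro n k hnk
    have h1 := hmin n (m k) (hanti hnk (hm k))
    rw [norm_sub_sq_real, real_inner_comm]
    linarith
  have hmono : Monotone fun n => ‖m n‖ ^ 2 := fun n k hnk => by
    have := hdist n k hnk
    have h0 := sq_nonneg ‖m k - m n‖
    simp only
    linarith
  have hlim := tendsto_atTop_ciSup hmono ⟨R ^ 2, by rintro _ ⟨n, rfl⟩; exact hle n⟩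
  set L := ⨆ n, ‖m n‖ ^ 2
  have hub : ∀ n, ‖m n‖ ^ 2 ≤ L := fun n => hmono.ge_of_tendsto hlim n
  have hcau : CauchySeq m := by
    refine cauchySeq_of_le_tendsto_0' (fun n => √(L - ‖m n‖ ^ 2)) ?_ ?_
    · intro n k hnk
      rw [dist_comm, dist_eq_norm]
      exact Real.le_sqrt_of_sq_le ((hdist n k hnk).trans (by linarith [hub k]))
    · have := (tendsto_const_nhds (x := L)).sub hlim
      rw [sub_self] at this
      simpa using this.sqrt
  obtain ⟨y, hy⟩ := cauchySeq_tendsto_of_complete hcau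
  refine ⟨y, mem_iInter.2 fun n => (hcl n).mem_of_tendsto hy ?_⟩
  filter_upwards [eventually_ge_atTop n] with k hk using hanti hk (hm k)

/-- A bounded sequence in a Hilbert space has a point that lies in every closed convex set
containing all but finitely many of its terms. -/
theorem exists_mem_closed_convex_of_bounded {H : Type*} [NormedAddCommGroup H]
    [InnerProductSpace ℝ H] [CompleteSpace H] (x : ℕ → H) (R : ℝ) (hR : ∀ n, ‖x n‖ ≤ R) :
    ∃ y, ∀ K : Set H, IsClosed K → Convex ℝ K → (∀ᶠ n in atTop, x n ∈ K) → y ∈ K := by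
  -- The closed convex hulls of the tails are nested and meet the ball of radius R. A common point
  -- serves as a weak cluster point, and no weak topology is needed.
  obtain ⟨y, hy⟩ := nonempty_iInter_of_closed_convex
    (fun n => closedConvexHull ℝ (x '' Ici n)) (fun n => isClosed_closedConvexHull)
    (fun n => convex_closedConvexHull)
    (fun n k hnk => (closedConvexHull ℝ).monotone (image_mono (Ici_subset_Ici.2 hnk))) R
    (fun n => ⟨x n, subset_closedConvexHull ⟨n, self_mem_Ici, rfl⟩, hR n⟩)
  refine ⟨y, fun K hK hKc hev => ?_⟩
  obtain ⟨N, hN⟩ := eventually_atTop.1 hev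
  refine closedConvexHull_min ?_ hKc hK (mem_iInter.1 hy N)
  rintro _ ⟨n, hn, rfl⟩
  exact hN n hn

/-- Minimizers of `‖T x + b‖` over a closed convex set, in terms of a variational inequality. -/
theorem exists_variational_inequality {H : Type*} [NormedAddCommGroup H]
    [InnerProductSpace ℝ H] [CompleteSpace H] (T : H →L[ℝ] H) {c : ℝ} (hc : 0 < c)
    (hT : ∀ x, c * ‖x‖ ≤ ‖T x‖) (b : H) {K : Set H} (hne : K.Nonempty) (hcl : IsClosed K)
    (hK : Convex ℝ K) : ∃ x ∈ K, ∀ y ∈ K, 0 ≤ inner ℝ (T x + b) (T (y - x)) := by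
  -- A map bounded below is a closed embedding, so T(K) is closed and convex, and −b can be
  -- projected onto it.
  have hanti : AntilipschitzWith (Real.toNNReal c⁻¹) T := by
    refine T.antilipschitz_of_bound fun x => ?_
    rw [Real.coe_toNNReal _ (inv_nonneg.2 hc.le), inv_mul_eq_div, le_div_iff₀' hc]
    exact hT x
  have hcl' : IsClosed (T '' K) :=
    (hanti.isClosedEmbedding T.uniformContinuous).isClosedMap _ hcl
  have hconv : Convex ℝ (T '' K) := hK.is_linear_image T.toLinearMap.isLinear
  obtain ⟨_, ⟨x, hx, rfl⟩, e⟩ := exists_norm_eq_iInf_of_complete_convex (hne.image T)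
    hcl'.isComplete hconv (-b)
  refine ⟨x, hx, fun y hy => ?_⟩
  have h := (norm_eq_iInf_iff_real_inner_le_zero hconv ⟨x, hx, rfl⟩).1 e (T y) ⟨y, hy, rfl⟩
  rw [show -b - T x = -(T x + b) by abel, inner_neg_left] at h
  rw [map_sub]
  linarith

/-! ### Square integrable jets and bounded operators on them -/

/-- The values of first order jets of functions on the plane. -/
abbrev JetValue : Type := WithLp 2 (ℝ × Plane)

/-- Square integrable pairs of a function and a vector field. -/
abbrev JetSpace : Type := Lp JetValue 2 (volume : Measure Plane)

theorem JetValue.norm_sq (z : JetValue) : ‖z‖ ^ 2 = z.fst ^ 2 + ‖z.snd‖ ^ 2 := by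
  rw [WithLp.prod_norm_sq_eq_of_L2, Real.norm_eq_abs, sq_abs]

theorem JetValue.abs_fst_le (z : JetValue) : |z.fst| ≤ ‖z‖ := by
  have h : z.fst ^ 2 ≤ ‖z‖ ^ 2 := by rw [z.norm_sq]; nlinarith [sq_nonneg ‖z.snd‖]
  exact abs_le_of_sq_le_sq h (norm_nonneg _)

theorem JetValue.norm_snd_le (z : JetValue) : ‖z.snd‖ ≤ ‖z‖ := by
  refine le_of_sq_le_sq ?_ (norm_nonneg _)
  rw [z.norm_sq]; nlinarith [sq_nonneg z.fst]

theorem JetValue.norm_le (z : JetValue) : ‖z‖ ≤ |z.fst| + ‖z.snd‖ := by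
  refine le_of_sq_le_sq ?_ (by positivity)
  rw [z.norm_sq, add_sq, sq_abs]; nlinarith [mul_nonneg (abs_nonneg z.fst) (norm_nonneg z.snd)]

@[fun_prop]
theorem JetValue.continuous_fst : Continuous (fun z : JetValue => z.fst) :=
  (WithLp.prod_continuous_ofLp 2 ℝ Plane).fst

@[fun_prop]
theorem JetValue.continuous_snd : Continuous (fun z : JetValue => z.snd) :=
  (WithLp.prod_continuous_ofLp 2 ℝ Plane).snd

/-- The coefficients of a bounded zeroth order operator `(u, G) ↦ (α u, u w + β G)`. -/
structure JetCoeff where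
  α : Plane → ℝ
  β : Plane → ℝ
  w : Plane → Plane
  measurable_α : Measurable α
  measurable_β : Measurable β
  measurable_w : Measurable w
  bound : ℝ
  abs_α_le : ∀ x, |α x| ≤ bound
  abs_β_le : ∀ x, |β x| ≤ bound
  norm_w_le : ∀ x, ‖w x‖ ≤ bound

namespace JetCoeff

/-- The pointwise action of the operator. -/
def act (A : JetCoeff) (x : Plane) (z : JetValue) : JetValue :=
  WithLp.toLp 2 (A.α x * z.fst, z.fst • A.w x + A.β x • z.snd)

@[simp] theorem act_fst (A : JetCoeff) (x : Plane) (z : JetValue) :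
    (A.act x z).fst = A.α x * z.fst := rfl

@[simp] theorem act_snd (A : JetCoeff) (x : Plane) (z : JetValue) :
    (A.act x z).snd = z.fst • A.w x + A.β x • z.snd := rfl

theorem norm_act_le (A : JetCoeff) (x : Plane) (z : JetValue) :
    ‖A.act x z‖ ≤ 3 * A.bound * ‖z‖ := by
  have hb : 0 ≤ A.bound := (abs_nonneg _).trans (A.abs_α_le x)
  have h1 : |A.α x * z.fst| ≤ A.bound * ‖z‖ := by
    rw [abs_mul]; exact mul_le_mul (A.abs_α_le x) z.abs_fst_le (abs_nonneg _) hb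
  have h2 : ‖z.fst • A.w x‖ ≤ A.bound * ‖z‖ := by
    rw [norm_smul, mul_comm, Real.norm_eq_abs]
    exact mul_le_mul (A.norm_w_le x) z.abs_fst_le (abs_nonneg _) hb
  have h3 : ‖A.β x • z.snd‖ ≤ A.bound * ‖z‖ := by
    rw [norm_smul]; exact mul_le_mul (A.abs_β_le x) z.norm_snd_le (norm_nonneg _) hb
  have h4 := (A.act x z).norm_le
  rw [act_fst, act_snd] at h4
  linarith [norm_add_le (z.fst • A.w x) (A.β x • z.snd)]

theorem aestronglyMeasurable_act (A : JetCoeff) {f : Plane → JetValue}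
    (hf : AEStronglyMeasurable f volume) :
    AEStronglyMeasurable (fun x => A.act x (f x)) volume := by
  have h1 : AEStronglyMeasurable (fun x => (f x).fst) volume :=
    JetValue.continuous_fst.comp_aestronglyMeasurable hf
  have h2 : AEStronglyMeasurable (fun x => (f x).snd) volume :=
    JetValue.continuous_snd.comp_aestronglyMeasurable hf
  exact (WithLp.prod_continuous_toLp 2 ℝ Plane).comp_aestronglyMeasurable
    ((A.measurable_α.aestronglyMeasurable.mul h1).prodMk
      ((h1.smul A.measurable_w.aestronglyMeasurable).add
        (A.measurable_β.aestronglyMeasurable.smul h2)))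

theorem memLp_act (A : JetCoeff) (f : JetSpace) :
    MemLp (fun x => A.act x (f x)) 2 volume :=
  MemLp.of_le_mul (Lp.memLp f) (A.aestronglyMeasurable_act (Lp.aestronglyMeasurable f))
    (Eventually.of_forall fun x => A.norm_act_le x (f x))

/-- The operator on square integrable jets. -/
def op (A : JetCoeff) : JetSpace →L[ℝ] JetSpace :=
  LinearMap.mkContinuous
    { toFun := fun f => (A.memLp_act f).toLp
      map_add' := fun f g => by
        rw [← MemLp.toLp_add]
        refine MemLp.toLp_congr _ _ ?_
        filter_upwards [Lp.coeFn_add f g] with x hx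
        rw [hx, Pi.add_apply]
        simp [act, ← WithLp.toLp_add, mul_add, add_smul, smul_add, add_add_add_comm]
      map_smul' := fun c f => by
        rw [RingHom.id_apply, ← MemLp.toLp_const_smul]
        refine MemLp.toLp_congr _ _ ?_
        filter_upwards [Lp.coeFn_smul c f] with x hx
        rw [hx, Pi.smul_apply]
        simp [act, ← WithLp.toLp_smul, mul_left_comm, smul_smul, mul_comm] }
    (3 * A.bound) (fun f => by
      refine Lp.norm_le_mul_norm_of_ae_le_mul ?_
      filter_upwards [(A.memLp_act f).coeFn_toLp] with x hx
      simp only [LinearMap.coe_mk, AddHom.coe_mk]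
      rw [hx]
      exact A.norm_act_le x (f x))

theorem coeFn_op (A : JetCoeff) (f : JetSpace) :
    A.op f =ᵐ[volume] fun x => A.act x (f x) := (A.memLp_act f).coeFn_toLp

end JetCoeff

/-! ### Gradient calculus, test functions and cutoffs -/

theorem HasGradientAt.add_fun {f g : Plane → ℝ} {f' g' x : Plane} (hf : HasGradientAt f f' x)
    (hg : HasGradientAt g g' x) : HasGradientAt (fun y => f y + g y) (f' + g') x := by
  rw [hasGradientAt_iff_hasFDerivAt, map_add]
  exact hf.hasFDerivAt.add hg.hasFDerivAt

theorem HasGradientAt.mul_fun {f g : Plane → ℝ} {f' g' x : Plane} (hf : HasGradientAt f f' x)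
    (hg : HasGradientAt g g' x) :
    HasGradientAt (fun y => f y * g y) (g x • f' + f x • g') x := by
  rw [hasGradientAt_iff_hasFDerivAt, map_add, map_smul, map_smul, add_comm]
  exact hf.hasFDerivAt.mul hg.hasFDerivAt

theorem HasGradientAt.scomp {f : Plane → ℝ} {f' x : Plane} (hf : HasGradientAt f f' x)
    {T : ℝ → ℝ} {c : ℝ} (hT : HasDerivAt T c (f x)) :
    HasGradientAt (fun y => T (f y)) (c • f') x := by
  rw [hasGradientAt_iff_hasFDerivAt, map_smul]
  exact hT.comp_hasFDerivAt x hf.hasFDerivAt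

theorem HasGradientAt.comp_translate {f : Plane → ℝ} {f' x s : Plane}
    (hf : HasGradientAt f f' (x - s)) : HasGradientAt (fun y => f (y - s)) f' x := by
  rw [hasGradientAt_iff_hasFDerivAt]
  exact (hasFDerivAt_comp_sub s).2 hf.hasFDerivAt

theorem ContDiff.hasGradientAt {f : Plane → ℝ} (hf : ContDiff ℝ ∞ f) (x : Plane) :
    HasGradientAt f (∇ f x) x := (hf.differentiable (by simp) x).hasGradientAt

theorem ContDiff.continuous_gradient {f : Plane → ℝ} (hf : ContDiff ℝ ∞ f) :
    Continuous (∇ f) :=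
  (InnerProductSpace.toDual ℝ Plane).symm.continuous.comp (hf.continuous_fderiv (by simp))

theorem HasCompactSupport.gradient {f : Plane → ℝ} (hf : HasCompactSupport f) :
    HasCompactSupport (∇ f) :=
  (hf.fderiv ℝ).comp_left (map_zero (InnerProductSpace.toDual ℝ Plane).symm)

theorem gradient_eq_zero_of_notMem_tsupport {f : Plane → ℝ} {x : Plane} (hx : x ∉ tsupport f) :
    ∇ f x = 0 := by
  have h : f =ᶠ[𝓝 x] fun _ => 0 := notMem_tsupport_iff_eventuallyEq.1 hx
  rw [h.gradient_eq, gradient_fun_const]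

namespace IsTestFunction

variable {O O' : Set Plane} {φ ψ : Plane → ℝ}

theorem mono (h : IsTestFunction O φ) (hO : O ⊆ O') : IsTestFunction O' φ :=
  ⟨h.smooth, h.compact, h.support_subset.trans hO⟩

theorem zero (O : Set Plane) : IsTestFunction O (fun _ => 0) :=
  ⟨contDiff_const, HasCompactSupport.zero, by
    rw [show (fun _ : Plane => (0 : ℝ)) = 0 from rfl, tsupport_zero]; exact empty_subset _⟩

theorem eq_zero (h : IsTestFunction O φ) {x : Plane} (hx : x ∉ O) : φ x = 0 :=
  image_eq_zero_of_notMem_tsupport fun h' => hx (h.support_subset h')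

theorem gradient_eq_zero (h : IsTestFunction O φ) {x : Plane} (hx : x ∉ O) : ∇ φ x = 0 :=
  gradient_eq_zero_of_notMem_tsupport fun h' => hx (h.support_subset h')

theorem of_tsupport_subset {K : Set Plane} (hφ : ContDiff ℝ ∞ φ) (hK : IsCompact K)
    (hKO : K ⊆ O) (h : ∀ x ∉ K, φ x = 0) : IsTestFunction O φ := by
  have hs : tsupport φ ⊆ K :=
    closure_minimal (fun x hx => by_contra fun h' => hx (h x h')) hK.isClosed
  exact ⟨hφ, hK.of_isClosed_subset (isClosed_tsupport φ) hs, hs.trans hKO⟩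

theorem add (hφ : IsTestFunction O φ) (hψ : IsTestFunction O ψ) :
    IsTestFunction O (fun x => φ x + ψ x) :=
  of_tsupport_subset (hφ.smooth.add hψ.smooth) (hφ.compact.isCompact.union hψ.compact.isCompact)
    (union_subset hφ.support_subset hψ.support_subset) fun x hx => by
      rw [image_eq_zero_of_notMem_tsupport fun h => hx (Or.inl h),
        image_eq_zero_of_notMem_tsupport fun h => hx (Or.inr h), add_zero]

theorem mul_of_smooth {θ : Plane → ℝ} (hφ : IsTestFunction O φ) (hθ : ContDiff ℝ ∞ θ) :
    IsTestFunction O (fun x => θ x * φ x) :=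
  of_tsupport_subset (hθ.mul hφ.smooth) hφ.compact hφ.support_subset fun x hx => by
    rw [image_eq_zero_of_notMem_tsupport hx, mul_zero]

theorem const_mul (hφ : IsTestFunction O φ) (c : ℝ) : IsTestFunction O (fun x => c * φ x) :=
  hφ.mul_of_smooth contDiff_const

theorem scomp (hφ : IsTestFunction O φ) {T : ℝ → ℝ} (hT : ContDiff ℝ ∞ T) (h0 : T 0 = 0) :
    IsTestFunction O (fun x => T (φ x)) :=
  of_tsupport_subset (hT.comp hφ.smooth) hφ.compact hφ.support_subset fun x hx => by
    rw [image_eq_zero_of_notMem_tsupport hx, h0]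

theorem translate (hφ : IsTestFunction univ φ) (s : Plane) :
    IsTestFunction univ (fun x => φ (x - s)) := by
  refine of_tsupport_subset (K := (fun x => x + s) '' tsupport φ)
    (hφ.smooth.comp (contDiff_id.sub contDiff_const))
    (hφ.compact.isCompact.image (continuous_id.add continuous_const)) (subset_univ _) ?_
  intro x hx
  exact image_eq_zero_of_notMem_tsupport fun h => hx ⟨x - s, h, sub_add_cancel x s⟩

end IsTestFunction

/-- A smooth cutoff function that is one near a compact set. -/
theorem exists_cutoff {K O : Set Plane} (hK : IsCompact K) (hO : IsOpen O) (hKO : K ⊆ O) :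
    ∃ χ, IsTestFunction O χ ∧ (∀ᶠ x in 𝓝ˢ K, χ x = 1) ∧ ∀ x, χ x ∈ Icc (0 : ℝ) 1 := by
  obtain ⟨L, hL, hKL, hLO⟩ := exists_compact_between hK hO hKO
  obtain ⟨f, h1, h0, hf⟩ := exists_contMDiffMap_one_nhds_of_subset_interior (n := (⊤ : ℕ∞))
    (modelWithCornersSelf ℝ Plane) hK.isClosed hKL
  exact ⟨f, IsTestFunction.of_tsupport_subset f.contMDiff.contDiff hL hLO h0, h1, hf⟩

/-! ### H¹₀ as a closed subspace of the jets -/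

/-- The pair of a function and its gradient. -/
def jetFun (φ : Plane → ℝ) (x : Plane) : JetValue := WithLp.toLp 2 (φ x, ∇ φ x)

@[simp] theorem jetFun_fst (φ : Plane → ℝ) (x : Plane) : (jetFun φ x).fst = φ x := rfl

@[simp] theorem jetFun_snd (φ : Plane → ℝ) (x : Plane) : (jetFun φ x).snd = ∇ φ x := rfl

theorem JetValue.ext {z z' : JetValue} (h1 : z.fst = z'.fst) (h2 : z.snd = z'.snd) : z = z' :=
  WithLp.ofLp_injective 2 (Prod.ext h1 h2)

namespace IsTestFunction

variable {O O' : Set Plane} {φ ψ : Plane → ℝ}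

theorem continuous_jetFun (h : IsTestFunction O φ) : Continuous (jetFun φ) :=
  (WithLp.prod_continuous_toLp 2 ℝ Plane).comp
    (h.smooth.continuous.prodMk h.smooth.continuous_gradient)

theorem hasCompactSupport_jetFun (h : IsTestFunction O φ) : HasCompactSupport (jetFun φ) :=
  HasCompactSupport.intro h.compact fun _ hx => JetValue.ext
    (image_eq_zero_of_notMem_tsupport (f := φ) hx) (gradient_eq_zero_of_notMem_tsupport hx)

theorem memLp_jetFun (h : IsTestFunction O φ) : MemLp (jetFun φ) 2 volume :=
  h.continuous_jetFun.memLp_of_hasCompactSupport h.hasCompactSupport_jetFun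

/-- The jet of a test function. -/
def jet (h : IsTestFunction O φ) : JetSpace := h.memLp_jetFun.toLp

theorem coeFn_jet (h : IsTestFunction O φ) : h.jet =ᵐ[volume] jetFun φ :=
  h.memLp_jetFun.coeFn_toLp

theorem jetFun_add (hφ : IsTestFunction O φ) (hψ : IsTestFunction O' ψ) (x : Plane) :
    jetFun (fun x => φ x + ψ x) x = jetFun φ x + jetFun ψ x :=
  JetValue.ext rfl
    ((hφ.smooth.hasGradientAt x).add_fun (hψ.smooth.hasGradientAt x)).gradient

theorem jetFun_const_mul (hφ : IsTestFunction O φ) (c : ℝ) (x : Plane) :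
    jetFun (fun x => c * φ x) x = c • jetFun φ x :=
  JetValue.ext rfl <| by
    have h := ((hasGradientAt_const x c).mul_fun (hφ.smooth.hasGradientAt x)).gradient
    rw [smul_zero, zero_add] at h
    exact h

theorem jet_add (hφ : IsTestFunction O φ) (hψ : IsTestFunction O ψ) :
    (hφ.add hψ).jet = hφ.jet + hψ.jet := by
  rw [jet, jet, jet, ← MemLp.toLp_add]
  exact MemLp.toLp_congr _ _ (Eventually.of_forall fun x => hφ.jetFun_add hψ x)

theorem jet_const_mul (hφ : IsTestFunction O φ) (c : ℝ) :
    (hφ.const_mul c).jet = c • hφ.jet := by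
  rw [jet, jet, ← MemLp.toLp_const_smul]
  exact MemLp.toLp_congr _ _ (Eventually.of_forall fun x => hφ.jetFun_const_mul c x)

end IsTestFunction

/-- The jets of the test functions on `O`. -/
def testJets (O : Set Plane) : Submodule ℝ JetSpace where
  carrier := {f | ∃ φ, ∃ h : IsTestFunction O φ, h.jet = f}
  add_mem' := by
    rintro _ _ ⟨φ, hφ, rfl⟩ ⟨ψ, hψ, rfl⟩
    exact ⟨_, hφ.add hψ, hφ.jet_add hψ⟩
  zero_mem' := ⟨_, (IsTestFunction.zero O).const_mul 0, by
    rw [(IsTestFunction.zero O).jet_const_mul, zero_smul]⟩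
  smul_mem' := by
    rintro c _ ⟨φ, hφ, rfl⟩
    exact ⟨_, hφ.const_mul c, hφ.jet_const_mul c⟩

/-- The jets of the functions of class `H¹₀(O)`, extended by zero. -/
def zeroTraceJets (O : Set Plane) : Submodule ℝ JetSpace := (testJets O).topologicalClosure

theorem isClosed_zeroTraceJets (O : Set Plane) : IsClosed (zeroTraceJets O : Set JetSpace) :=
  (testJets O).isClosed_topologicalClosure

theorem IsTestFunction.jet_mem {O : Set Plane} {φ : Plane → ℝ} (h : IsTestFunction O φ) :
    h.jet ∈ zeroTraceJets O := (testJets O).le_topologicalClosure ⟨φ, h, rfl⟩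

theorem testJets_mono {O O' : Set Plane} (h : O ⊆ O') : testJets O ≤ testJets O' := by
  rintro _ ⟨φ, hφ, rfl⟩
  exact ⟨φ, hφ.mono h, rfl⟩

theorem zeroTraceJets_mono {O O' : Set Plane} (h : O ⊆ O') :
    zeroTraceJets O ≤ zeroTraceJets O' := Submodule.topologicalClosure_mono (testJets_mono h)

theorem exists_seq_of_mem_zeroTraceJets {O : Set Plane} {x : JetSpace}
    (hx : x ∈ zeroTraceJets O) : ∃ (φ : ℕ → Plane → ℝ) (h : ∀ n, IsTestFunction O (φ n)),
      Tendsto (fun n => (h n).jet) atTop (𝓝 x) := by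
  obtain ⟨f, hf, hlim⟩ := mem_closure_iff_seq_limit.1 hx
  choose φ h e using hf
  exact ⟨φ, h, by simpa only [e] using hlim⟩

/-- A continuous linear map carries `H¹₀(O)` into a closed subspace if it does so for test
functions. -/
theorem zeroTraceJets_induction {O : Set Plane} {F : Type*} [NormedAddCommGroup F]
    [NormedSpace ℝ F] (T : JetSpace →L[ℝ] F) {Z : Submodule ℝ F} (hZ : IsClosed (Z : Set F))
    (h : ∀ φ (hφ : IsTestFunction O φ), T hφ.jet ∈ Z) {x : JetSpace} (hx : x ∈ zeroTraceJets O) :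
    T x ∈ Z := by
  obtain ⟨φ, hφ, hlim⟩ := exists_seq_of_mem_zeroTraceJets hx
  exact hZ.mem_of_tendsto ((T.continuous.tendsto x).comp hlim)
    (Eventually.of_forall fun n => h _ (hφ n))

namespace JetCoeff

/-- Multiplication by a bounded smooth function with bounded gradient. -/
def ofSmooth {θ : Plane → ℝ} (hθ : ContDiff ℝ ∞ θ) {C : ℝ} (h0 : ∀ x, |θ x| ≤ C)
    (h1 : ∀ x, ‖∇ θ x‖ ≤ C) : JetCoeff where
  α := θ
  β := θ
  w := ∇ θ
  measurable_α := hθ.continuous.measurable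
  measurable_β := hθ.continuous.measurable
  measurable_w := hθ.continuous_gradient.measurable
  bound := C
  abs_α_le := h0
  abs_β_le := h0
  norm_w_le := h1

theorem op_ofSmooth_jet {O O' : Set Plane} {θ φ : Plane → ℝ} (hθ : ContDiff ℝ ∞ θ) {C : ℝ}
    (h0 : ∀ x, |θ x| ≤ C) (h1 : ∀ x, ‖∇ θ x‖ ≤ C) (hφ : IsTestFunction O φ)
    (hθφ : IsTestFunction O' (fun x => θ x * φ x)) :
    (ofSmooth hθ h0 h1).op hφ.jet = hθφ.jet := by
  refine Lp.ext ?_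
  filter_upwards [coeFn_op (ofSmooth hθ h0 h1) hφ.jet, hφ.coeFn_jet, hθφ.coeFn_jet]
    with x e1 e2 e3
  rw [e1, e2, e3]
  exact JetValue.ext rfl
    ((hθ.hasGradientAt x).mul_fun (hφ.smooth.hasGradientAt x)).gradient.symm

/-- Restriction to a measurable set. -/
def restrict {A : Set Plane} (hA : MeasurableSet A) : JetCoeff where
  α := A.indicator 1
  β := A.indicator 1
  w := 0
  measurable_α := measurable_one.indicator hA
  measurable_β := measurable_one.indicator hA
  measurable_w := measurable_zero
  bound := 1
  abs_α_le x := by by_cases hx : x ∈ A <;> simp [hx]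
  abs_β_le x := by by_cases hx : x ∈ A <;> simp [hx]
  norm_w_le x := by simp

theorem restrict_act_of_mem {A : Set Plane} (hA : MeasurableSet A) {x : Plane} (hx : x ∈ A)
    (z : JetValue) : (restrict hA).act x z = z :=
  JetValue.ext (by simp [restrict, hx]) (by simp [restrict, hx])

theorem restrict_act_of_notMem {A : Set Plane} (hA : MeasurableSet A) {x : Plane} (hx : x ∉ A)
    (z : JetValue) : (restrict hA).act x z = 0 :=
  JetValue.ext (by simp [restrict, hx]) (by simp [restrict, hx])

end JetCoeff

theorem IsTestFunction.exists_bound {O : Set Plane} {φ : Plane → ℝ} (h : IsTestFunction O φ) :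
    ∃ C, (∀ x, |φ x| ≤ C) ∧ ∀ x, ‖∇ φ x‖ ≤ C := by
  obtain ⟨C, hC⟩ := h.continuous_jetFun.bounded_above_of_compact_support h.hasCompactSupport_jetFun
  exact ⟨C, fun x => (jetFun φ x).abs_fst_le.trans (hC x),
    fun x => (jetFun φ x).norm_snd_le.trans (hC x)⟩

/-- The jets vanishing off O form the kernel of a continuous operator, so the property passes from
test functions to their limits. -/
theorem ae_eq_zero_of_mem_zeroTraceJets {O : Set Plane} (hO : MeasurableSet O) {x : JetSpace}
    (hx : x ∈ zeroTraceJets O) : ∀ᵐ y, y ∉ O → x y = 0 := by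
  have h : (JetCoeff.restrict hO.compl).op x ∈ (⊥ : Submodule ℝ JetSpace) := by
    refine zeroTraceJets_induction _ (by simp) (fun φ hφ => ?_) hx
    rw [Submodule.mem_bot]
    refine Lp.ext ?_
    filter_upwards [JetCoeff.coeFn_op (JetCoeff.restrict hO.compl) hφ.jet, hφ.coeFn_jet,
      Lp.coeFn_zero JetValue 2 (volume : Measure Plane)] with y e1 e2 e3
    rw [e1, e2, e3, Pi.zero_apply]
    by_cases hy : y ∈ O
    · exact JetCoeff.restrict_act_of_notMem _ (by simpa using hy) _
    · rw [JetCoeff.restrict_act_of_mem _ hy]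
      exact JetValue.ext (hφ.eq_zero hy) (hφ.gradient_eq_zero hy)
  rw [Submodule.mem_bot] at h
  have e0 := JetCoeff.coeFn_op (JetCoeff.restrict hO.compl) x
  rw [h] at e0
  filter_upwards [e0, Lp.coeFn_zero JetValue 2 (volume : Measure Plane)] with y e1 e2 hy
  rw [e2, Pi.zero_apply, JetCoeff.restrict_act_of_mem _ hy] at e1
  exact e1.symm

/-! ### Weak gradients and the dictionary between jets and H¹₀ functions -/

/-- Members of `H¹₀` satisfy the definition of the weak gradient, even for test functions that do
not vanish on the boundary. -/
theorem integral_fst_mul_add_eq_zero {O : Set Plane} {x : JetSpace} (hx : x ∈ zeroTraceJets O)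
    {φ : Plane → ℝ} (hφ : IsTestFunction univ φ) (e : Plane) :
    ∫ y, ((x y).fst * inner ℝ (∇ φ y) e + φ y * inner ℝ (x y).snd e) = 0 := by
  have hF : Continuous fun y => (WithLp.toLp 2 (inner ℝ (∇ φ y) e, φ y • e) : JetValue) :=
    (WithLp.prod_continuous_toLp 2 ℝ Plane).comp
      ((hφ.smooth.continuous_gradient.inner continuous_const).prodMk
        (hφ.smooth.continuous.smul continuous_const))
  have hF2 : MemLp (fun y => (WithLp.toLp 2 (inner ℝ (∇ φ y) e, φ y • e) : JetValue)) 2 volume := by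
    refine hF.memLp_of_hasCompactSupport (HasCompactSupport.intro hφ.compact fun y hy => ?_)
    refine JetValue.ext ?_ ?_
    · simp [gradient_eq_zero_of_notMem_tsupport hy]
    · simp [image_eq_zero_of_notMem_tsupport hy]
  have hin : ∀ z : JetSpace, inner ℝ hF2.toLp z =
      ∫ y, ((z y).fst * inner ℝ (∇ φ y) e + φ y * inner ℝ (z y).snd e) := by
    intro z
    rw [L2.inner_def]
    refine integral_congr_ae ?_
    filter_upwards [hF2.coeFn_toLp] with y hy
    rw [hy, WithLp.prod_inner_apply]
    change inner ℝ (inner ℝ (∇ φ y) e) (z y).fst + inner ℝ (φ y • e) (z y).snd = _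
    rw [real_inner_smul_left, real_inner_comm e (z y).snd]
    rfl
  rw [← hin]
  -- The integral is an inner product with a fixed square integrable jet, hence continuous in x. It
  -- is enough to treat test functions, where it vanishes by integration by parts.
  suffices h : innerSL ℝ hF2.toLp x ∈ (⊥ : Submodule ℝ ℝ) by simpa using h
  refine zeroTraceJets_induction _ (by simp) (fun ψ hψ => ?_) hx
  rw [Submodule.mem_bot, innerSL_apply_apply, hin]
  have hint : ∀ {f g : Plane → ℝ}, Continuous f → HasCompactSupport f → Continuous g →
      Integrable (fun y => f y * g y) volume := fun hf hfc hg =>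
    (hf.mul hg).integrable_of_hasCompactSupport hfc.mul_right
  have hd : ∀ {f : Plane → ℝ}, ContDiff ℝ ∞ f → Continuous fun y => fderiv ℝ f y e :=
    fun hf => (hf.continuous_fderiv (by simp)).clm_apply continuous_const
  have hdc : HasCompactSupport fun y => fderiv ℝ ψ y e := by
    refine HasCompactSupport.intro hψ.compact fun y hy => ?_
    rw [← inner_gradient_left, gradient_eq_zero_of_notMem_tsupport hy, inner_zero_left]
  have i1 := hint hψ.smooth.continuous hψ.compact (hd hφ.smooth)
  have i2 := hint (hd hψ.smooth) hdc hφ.smooth.continuous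
  have i3 := hint hψ.smooth.continuous hψ.compact hφ.smooth.continuous
  have key := integral_mul_fderiv_eq_neg_fderiv_mul_of_integrable i2 i1 i3
    (fun y _ => hψ.smooth.differentiable (by simp) y)
    (fun y _ => hφ.smooth.differentiable (by simp) y)
  calc ∫ y, ((hψ.jet y).fst * inner ℝ (∇ φ y) e + φ y * inner ℝ (hψ.jet y).snd e)
      = ∫ y, (ψ y * fderiv ℝ φ y e + fderiv ℝ ψ y e * φ y) := by
        refine integral_congr_ae ?_
        filter_upwards [hψ.coeFn_jet] with y hy
        rw [hy, jetFun_fst, jetFun_snd, inner_gradient_left, inner_gradient_left,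
          mul_comm (φ y)]
    _ = 0 := by rw [integral_add i1 i2, key, neg_add_cancel]

theorem memLp_fst (x : JetSpace) : MemLp (fun y => (x y).fst) 2 volume :=
  (Lp.memLp x).of_le
    (JetValue.continuous_fst.comp_aestronglyMeasurable (Lp.aestronglyMeasurable x))
    (Eventually.of_forall fun y => (x y).abs_fst_le)

theorem memLp_snd (x : JetSpace) : MemLp (fun y => (x y).snd) 2 volume :=
  (Lp.memLp x).of_le
    (JetValue.continuous_snd.comp_aestronglyMeasurable (Lp.aestronglyMeasurable x))
    (Eventually.of_forall fun y => (x y).norm_snd_le)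

/-- The second component of a member of `H¹₀(O)` is the weak gradient of the first one. -/
theorem isWeakGradient_of_mem {O : Set Plane} {x : JetSpace}
    (hx : x ∈ zeroTraceJets O) {u : Plane → ℝ}
    (hu : (fun y => (x y).fst) =ᵐ[volume.restrict O] u) :
    IsWeakGradient O u (fun y => (x y).snd) := by
  refine ⟨(memLp_snd x).restrict O, fun φ hφ => ?_⟩
  have hφ2 : MemLp φ 2 volume := hφ.smooth.continuous.memLp_of_hasCompactSupport hφ.compact
  have hd2 : MemLp (∇ φ) 2 volume :=
    hφ.smooth.continuous_gradient.memLp_of_hasCompactSupport hφ.compact.gradient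
  have i1 : Integrable (fun y => (x y).fst • ∇ φ y) volume :=
    memLp_one_iff_integrable.1 (hd2.smul (memLp_fst x))
  have i2 : Integrable (fun y => φ y • (x y).snd) volume :=
    memLp_one_iff_integrable.1 ((memLp_snd x).smul hφ2)
  have e1 : ∫ y in O, u y • ∇ φ y = ∫ y, (x y).fst • ∇ φ y := by
    have h0 : ∀ y, y ∉ O → (x y).fst • ∇ φ y = 0 := fun y hy => by
      rw [hφ.gradient_eq_zero hy, smul_zero]
    rw [← setIntegral_eq_integral_of_forall_compl_eq_zero h0]
    refine integral_congr_ae ?_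
    filter_upwards [hu] with y hy
    rw [hy]
  have e2 : ∫ y in O, φ y • (x y).snd = ∫ y, φ y • (x y).snd :=
    setIntegral_eq_integral_of_forall_compl_eq_zero fun y hy => by
      rw [hφ.eq_zero hy, zero_smul]
  rw [e1, e2, eq_neg_iff_add_eq_zero, ← integral_add i1 i2]
  refine ext_inner_left ℝ fun e => ?_
  refine (integral_inner (i1.add i2) e).symm.trans ?_
  rw [inner_zero_right]
  rw [← integral_fst_mul_add_eq_zero hx (hφ.mono (subset_univ _)) e]
  refine integral_congr_ae (Eventually.of_forall fun y => ?_)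
  simp only [Pi.add_apply, inner_add_right, real_inner_smul_right, real_inner_comm e]

/-- A member of `H¹₀(O)` is determined by its first component. -/
theorem eq_of_fst_ae_eq {x y : JetSpace} {O O' : Set Plane} (hx : x ∈ zeroTraceJets O)
    (hy : y ∈ zeroTraceJets O') (h : ∀ᵐ z, (x z).fst = (y z).fst) : x = y := by
  -- Both jets are weakly differentiable on the whole plane, so O and O' need not be related, and
  -- uniqueness of weak gradients there settles the second component.
  have hx' := isWeakGradient_of_mem (zeroTraceJets_mono (subset_univ _) hx)
    (u := fun z => (y z).fst) (by rw [Measure.restrict_univ]; exact h)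
  have hy' := isWeakGradient_of_mem (zeroTraceJets_mono (subset_univ _) hy)
    (u := fun z => (y z).fst) EventuallyEq.rfl
  have h2 := hx'.ae_eq isOpen_univ hy'
  rw [Measure.restrict_univ] at h2
  refine Lp.ext ?_
  filter_upwards [h, h2] with z h1 h2
  exact JetValue.ext h1 h2

/-- Test functions on Ω vanish off Ω together with their gradients. Convergence in H¹(Ω) is
therefore convergence in `JetSpace` to the pair extended by zero, and all domains share one Hilbert
space. -/
theorem MemH10.exists_jet {Ω : Set Plane} (hΩ : MeasurableSet Ω) {u : Plane → ℝ}
    (h : MemH10 Ω u) : ∃ x ∈ zeroTraceJets Ω, ∀ᵐ y ∂volume.restrict Ω,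
      (x y).fst = u y ∧ (x y).snd = weakGradient Ω u y := by
  obtain ⟨φ, hφ, h1, h2⟩ := h.exists_approx
  have hu := h.memH1.memLp
  have hG := h.memH1.isWeakGradient.memLp
  set F : Plane → JetValue := fun y => WithLp.toLp 2 (u y, weakGradient Ω u y) with hFdef
  have hFm : AEStronglyMeasurable F (volume.restrict Ω) :=
    (WithLp.prod_continuous_toLp 2 ℝ Plane).comp_aestronglyMeasurable
      (hu.aestronglyMeasurable.prodMk hG.aestronglyMeasurable)
  have hF : MemLp F 2 (volume.restrict Ω) := by
    refine (hu.norm.add hG.norm).of_le hFm (Eventually.of_forall fun y => ?_)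
    refine (JetValue.norm_le _).trans (le_abs_self _)
  have hF' : MemLp (Ω.indicator F) 2 volume := (memLp_indicator_iff_restrict hΩ).2 hF
  have hlim : Tendsto (fun n => (hφ n).jet) atTop (𝓝 hF'.toLp) := by
    refine (Lp.tendsto_Lp_iff_tendsto_eLpNorm'' _ (fun n => (hφ n).memLp_jetFun) _ hF').2 ?_
    refine tendsto_of_tendsto_of_tendsto_of_le_of_le tendsto_const_nhds
      (by simpa using h1.add h2) (fun n => zero_le) fun n => ?_
    have e : jetFun (φ n) - Ω.indicator F = Ω.indicator (jetFun (φ n) - F) := by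
      ext1 y
      by_cases hy : y ∈ Ω
      · simp [hy]
      · simp only [Pi.sub_apply, indicator_of_notMem hy, sub_zero]
        exact JetValue.ext ((hφ n).eq_zero hy) ((hφ n).gradient_eq_zero hy)
    rw [e, eLpNorm_indicator_eq_eLpNorm_restrict hΩ]
    have hm1 : AEStronglyMeasurable (φ n - u) (volume.restrict Ω) :=
      (hφ n).smooth.continuous.aestronglyMeasurable.sub hu.aestronglyMeasurable
    have hm2 : AEStronglyMeasurable (∇ (φ n) - weakGradient Ω u) (volume.restrict Ω) :=
      (hφ n).smooth.continuous_gradient.aestronglyMeasurable.sub hG.aestronglyMeasurable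
    calc eLpNorm (jetFun (φ n) - F) 2 (volume.restrict Ω)
        ≤ eLpNorm ((fun y => ‖(φ n - u) y‖) + fun y => ‖(∇ (φ n) - weakGradient Ω u) y‖) 2
            (volume.restrict Ω) := by
          refine eLpNorm_mono fun y => ?_
          exact (JetValue.norm_le _).trans (le_abs_self _)
      _ ≤ _ := eLpNorm_add_le hm1.norm hm2.norm (by norm_num)
      _ = _ := by rw [eLpNorm_norm, eLpNorm_norm]
  refine ⟨hF'.toLp, (isClosed_zeroTraceJets Ω).mem_of_tendsto hlim
    (Eventually.of_forall fun n => (hφ n).jet_mem), ?_⟩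
  filter_upwards [ae_restrict_of_ae hF'.coeFn_toLp, ae_restrict_mem hΩ] with y hy hyΩ
  rw [hy, indicator_of_mem hyΩ]
  exact ⟨rfl, rfl⟩

theorem weakGradient_ae_eq {Ω : Set Plane} (hΩ : IsOpen Ω) {u : Plane → ℝ} {G : Plane → Plane}
    (h : IsWeakGradient Ω u G) : weakGradient Ω u =ᵐ[volume.restrict Ω] G := by
  have hex : ∃ G, IsWeakGradient Ω u G := ⟨G, h⟩
  have : IsWeakGradient Ω u (weakGradient Ω u) := by
    rw [weakGradient, dif_pos hex]; exact hex.choose_spec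
  exact this.ae_eq hΩ h

theorem memH10_of_mem {Ω : Set Plane} (hΩ : IsOpen Ω) {x : JetSpace} (hx : x ∈ zeroTraceJets Ω)
    {u : Plane → ℝ} (hu : (fun y => (x y).fst) =ᵐ[volume.restrict Ω] u) : MemH10 Ω u := by
  have hG := isWeakGradient_of_mem hx hu
  have hw := weakGradient_ae_eq hΩ hG
  obtain ⟨φ, hφ, hlim⟩ := exists_seq_of_mem_zeroTraceJets hx
  have hlim' := (Lp.tendsto_Lp_iff_tendsto_eLpNorm' _ _).1 hlim
  refine ⟨⟨((memLp_fst x).restrict Ω).ae_eq hu, _, hG⟩, φ, hφ, ?_, ?_⟩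
  · refine tendsto_of_tendsto_of_tendsto_of_le_of_le tendsto_const_nhds hlim'
      (fun n => zero_le) fun n => ?_
    refine (eLpNorm_mono_ae ?_).trans (eLpNorm_restrict_le _ _ _ Ω)
    filter_upwards [hu, ae_restrict_of_ae (hφ n).coeFn_jet] with y h1 h2
    rw [Pi.sub_apply, Pi.sub_apply, h2, ← h1]
    exact JetValue.abs_fst_le (jetFun (φ n) y - x y)
  · refine tendsto_of_tendsto_of_tendsto_of_le_of_le tendsto_const_nhds hlim'
      (fun n => zero_le) fun n => ?_
    refine (eLpNorm_mono_ae ?_).trans (eLpNorm_restrict_le _ _ _ Ω)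
    filter_upwards [hw, ae_restrict_of_ae (hφ n).coeFn_jet] with y h1 h2
    rw [Pi.sub_apply, Pi.sub_apply, h2, h1]
    exact JetValue.norm_snd_le (jetFun (φ n) y - x y)

/-! ### Truncation by smooth contractions -/

theorem JetSpace.norm_sq (x : JetSpace) : ‖x‖ ^ 2 = ∫ y, ‖x y‖ ^ 2 := by
  rw [← real_inner_self_eq_norm_sq, L2.inner_def]
  simp only [real_inner_self_eq_norm_sq]

theorem JetSpace.norm_le_norm {x y : JetSpace} (h : ∀ᵐ z, ‖x z‖ ≤ ‖y z‖) : ‖x‖ ≤ ‖y‖ :=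
  Lp.norm_le_norm_of_ae_le h

/-- A smooth contraction of the real line that fixes the origin. -/
structure IsSmoothContraction (T : ℝ → ℝ) : Prop where
  smooth : ContDiff ℝ ∞ T
  map_zero : T 0 = 0
  abs_deriv_le : ∀ s, |deriv T s| ≤ 1

namespace IsSmoothContraction

theorem hasDerivAt {T : ℝ → ℝ} (hT : IsSmoothContraction T) (s : ℝ) :
    HasDerivAt T (deriv T s) s := (hT.smooth.differentiable (by simp) s).hasDerivAt

theorem abs_sub_le {T : ℝ → ℝ} (hT : IsSmoothContraction T) (s t : ℝ) :
    |T s - T t| ≤ |s - t| := by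
  have h := Convex.norm_image_sub_le_of_norm_deriv_le (s := univ) (C := 1) (f := T) (x := t)
    (y := s) (fun r _ => (hT.hasDerivAt r).differentiableAt) (fun r _ => hT.abs_deriv_le r)
    convex_univ (mem_univ _) (mem_univ _)
  simpa using h

theorem abs_le {T : ℝ → ℝ} (hT : IsSmoothContraction T) (s : ℝ) : |T s| ≤ |s| := by
  simpa [hT.map_zero] using hT.abs_sub_le s 0

theorem comp {T : ℝ → ℝ} (hT : IsSmoothContraction T) {O : Set Plane} {φ : Plane → ℝ}
    (hφ : IsTestFunction O φ) : IsTestFunction O (fun x => T (φ x)) :=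
  hφ.scomp hT.smooth hT.map_zero

theorem gradient_comp {T : ℝ → ℝ} (hT : IsSmoothContraction T) {O : Set Plane}
    {φ : Plane → ℝ} (hφ : IsTestFunction O φ) (x : Plane) :
    ∇ (fun x => T (φ x)) x = deriv T (φ x) • ∇ φ x :=
  ((hφ.smooth.hasGradientAt x).scomp (hT.hasDerivAt (φ x))).gradient

end IsSmoothContraction

/-- Diagonal operators do not increase under contractions. -/
theorem JetCoeff.norm_op_jet_comp_le (W : JetCoeff) (hW : W.w = 0) {T : ℝ → ℝ}
    (hT : IsSmoothContraction T) {O : Set Plane} {φ : Plane → ℝ} (hφ : IsTestFunction O φ) :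
    ‖W.op (hT.comp hφ).jet‖ ≤ ‖W.op hφ.jet‖ := by
  refine JetSpace.norm_le_norm ?_
  filter_upwards [W.coeFn_op hφ.jet, W.coeFn_op (hT.comp hφ).jet, hφ.coeFn_jet,
    (hT.comp hφ).coeFn_jet] with z e1 e2 e3 e4
  rw [e1, e2, e3, e4]
  refine le_of_sq_le_sq ?_ (norm_nonneg _)
  rw [JetValue.norm_sq, JetValue.norm_sq]
  simp only [act_fst, act_snd, hW, Pi.zero_apply, smul_zero, zero_add, jetFun_fst, jetFun_snd,
    hT.gradient_comp hφ, norm_smul, mul_pow]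
  have h1 : T (φ z) ^ 2 ≤ φ z ^ 2 := sq_le_sq.2 (hT.abs_le _)
  have h2 : ‖deriv T (φ z)‖ ^ 2 ≤ 1 := by
    rw [Real.norm_eq_abs, sq_abs, sq_le_one_iff_abs_le_one]; exact hT.abs_deriv_le _
  gcongr
  exact mul_le_of_le_one_left (by positivity) h2

/-- The diagonal operator `(u, G) ↦ (u, 0)`. -/
def JetCoeff.fstCoeff : JetCoeff where
  α := 1
  β := 0
  w := 0
  measurable_α := measurable_one
  measurable_β := measurable_zero
  measurable_w := measurable_zero
  bound := 1
  abs_α_le x := by simp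
  abs_β_le x := by simp
  norm_w_le x := by simp

/-- The diagonal operator `(u, G) ↦ (u, G)`. -/
def JetCoeff.idCoeff : JetCoeff where
  α := 1
  β := 1
  w := 0
  measurable_α := measurable_one
  measurable_β := measurable_one
  measurable_w := measurable_zero
  bound := 1
  abs_α_le x := by simp
  abs_β_le x := by simp
  norm_w_le x := by simp

theorem JetCoeff.op_idCoeff (x : JetSpace) : JetCoeff.idCoeff.op x = x := by
  refine Lp.ext ?_
  filter_upwards [JetCoeff.idCoeff.coeFn_op x] with y hy
  rw [hy]
  exact JetValue.ext (by simp [idCoeff]) (by simp [idCoeff])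

/-- These are the sets to which the weak limit is tested: norm convergence or norm bounds for T
along a sequence pass to its weak limit. -/
theorem closedBall_preimage_convex {T : JetSpace →L[ℝ] JetSpace} (l : JetSpace) (r : ℝ) :
    IsClosed {y | ‖T y - l‖ ≤ r} ∧ Convex ℝ {y | ‖T y - l‖ ≤ r} := by
  have e : {y | ‖T y - l‖ ≤ r} = T ⁻¹' Metric.closedBall l r := by
    ext y; simp [dist_eq_norm]
  rw [e]
  exact ⟨Metric.isClosed_closedBall.preimage T.continuous,
    (convex_closedBall l r).linear_preimage T.toLinearMap⟩

/-- Composition of members of `H¹₀(O)` with limits of smooth contractions. -/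
theorem exists_comp_mem_zeroTraceJets {O : Set Plane} {x : JetSpace} (hx : x ∈ zeroTraceJets O)
    {T : ℕ → ℝ → ℝ} (hT : ∀ k, IsSmoothContraction (T k)) {S : ℝ → ℝ}
    (hS : ∀ s, Tendsto (fun k => T k s) atTop (𝓝 (S s))) :
    ∃ y ∈ zeroTraceJets O, (∀ᵐ z, (y z).fst = S (x z).fst) ∧
      (∀ W : JetCoeff, W.w = 0 → ‖W.op y‖ ≤ ‖W.op x‖) ∧
      ∀ K : Set JetSpace, IsClosed K → Convex ℝ K →
        (∀ k φ (hφ : IsTestFunction O φ), ((hT k).comp hφ).jet ∈ K) → y ∈ K := by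
  obtain ⟨φ, hφ, hlim⟩ := exists_seq_of_mem_zeroTraceJets hx
  set X : ℕ → JetSpace := fun k => ((hT k).comp (hφ k)).jet with hX
  have hop : ∀ (W : JetCoeff), W.w = 0 → ∀ k, ‖W.op (X k)‖ ≤ ‖W.op (hφ k).jet‖ :=
    fun W hW k => W.norm_op_jet_comp_le hW (hT k) (hφ k)
  obtain ⟨R, hR⟩ := hlim.norm.bddAbove_range
  -- Test function and contraction run along the same index. Contractions do not increase the norm
  -- of a jet, so the sequence is bounded and has a weak limit y.
  obtain ⟨y, hy⟩ := exists_mem_closed_convex_of_bounded X R fun k => by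
    have h := hop JetCoeff.idCoeff rfl k
    rw [JetCoeff.op_idCoeff, JetCoeff.op_idCoeff] at h
    exact h.trans (hR ⟨k, rfl⟩)
  refine ⟨y, hy _ (isClosed_zeroTraceJets O) (zeroTraceJets O).convex
    (Eventually.of_forall fun k => ((hT k).comp (hφ k)).jet_mem), ?_, ?_,
    fun K hK hKc h => hy K hK hKc (Eventually.of_forall fun k => h k _ (hφ k))⟩
  · have hSle : ∀ s, |S s| ≤ |s| := fun s =>
      le_of_tendsto (hS s).abs (Eventually.of_forall fun k => (hT k).abs_le s)
    have hSm : Measurable S := measurable_of_tendsto_metrizable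
      (fun k => (hT k).smooth.continuous.measurable) (tendsto_pi_nhds.2 hS)
    have hu := memLp_fst x
    have hmem : ∀ R : ℝ → ℝ, Measurable R → (∀ s, |R s| ≤ |s|) →
        MemLp (fun z => (WithLp.toLp 2 (R (x z).fst, 0) : JetValue)) 2 volume := by
      intro R hRm hR
      refine hu.of_le ((WithLp.prod_continuous_toLp 2 ℝ Plane).comp_aestronglyMeasurable
        ((hRm.comp_aemeasurable hu.aestronglyMeasurable.aemeasurable).aestronglyMeasurable.prodMk
          aestronglyMeasurable_const)) (Eventually.of_forall fun z => ?_)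
      refine (JetValue.norm_le _).trans ?_
      simpa using hR _
    set l := (hmem S hSm hSle).toLp with hl
    set J := JetCoeff.fstCoeff.op with hJ
    have g := fun k => hmem (T k) (hT k).smooth.continuous.measurable (hT k).abs_le
    have h1 : ∀ k, ‖J (X k) - (g k).toLp‖ ≤ ‖J (hφ k).jet - J x‖ := by
      intro k
      rw [← map_sub J (hφ k).jet x]
      refine JetSpace.norm_le_norm ?_
      filter_upwards [Lp.coeFn_sub (J (X k)) (g k).toLp, (g k).coeFn_toLp,
        JetCoeff.fstCoeff.coeFn_op (X k), JetCoeff.fstCoeff.coeFn_op ((hφ k).jet - x),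
        Lp.coeFn_sub (hφ k).jet x, ((hT k).comp (hφ k)).coeFn_jet, (hφ k).coeFn_jet]
        with z e1 e2 e3 e4 e5 e6 e7
      rw [e1, Pi.sub_apply, e2, e3, e4, e5, Pi.sub_apply, e6, e7]
      refine le_of_sq_le_sq ?_ (norm_nonneg _)
      rw [JetValue.norm_sq, JetValue.norm_sq]
      simpa [JetCoeff.fstCoeff] using sq_le_sq.2 ((hT k).abs_sub_le (φ k z) (x z).fst)
    have h2 : Tendsto (fun k => ‖(g k).toLp - l‖) atTop (𝓝 0) := by
      have hsq : Tendsto (fun k => ‖(g k).toLp - l‖ ^ 2) atTop (𝓝 0) := by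
        have e : ∀ k, ‖(g k).toLp - l‖ ^ 2 = ∫ z, (T k (x z).fst - S (x z).fst) ^ 2 := by
          intro k
          rw [JetSpace.norm_sq]
          refine integral_congr_ae ?_
          filter_upwards [Lp.coeFn_sub (g k).toLp l, (g k).coeFn_toLp,
            (hmem S hSm hSle).coeFn_toLp] with z e1 e2 e3
          rw [e1, Pi.sub_apply, e2, e3, JetValue.norm_sq]
          simp
        simp only [e]
        have hae := hu.aestronglyMeasurable.aemeasurable
        rw [show (0 : ℝ) = ∫ _ : Plane, (0 : ℝ) by simp]
        refine tendsto_integral_of_dominated_convergence (fun z => 4 * ((x z).fst) ^ 2)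
          (fun k => ?_) (hu.integrable_sq.const_mul 4) (fun k => Eventually.of_forall fun z => ?_)
          (Eventually.of_forall fun z => ?_)
        · exact ((((hT k).smooth.continuous.measurable.comp_aemeasurable hae).sub
            (hSm.comp_aemeasurable hae)).pow_const 2).aestronglyMeasurable
        · rw [Real.norm_eq_abs, abs_of_nonneg (sq_nonneg _)]
          have a1 := (hT k).abs_le (x z).fst
          have a2 := hSle (x z).fst
          have a3 := abs_sub (T k (x z).fst) (S (x z).fst)
          have a4 : |T k (x z).fst - S (x z).fst| ≤ |2 * (x z).fst| := by
            rw [abs_mul, abs_two]; linarith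
          have := sq_le_sq.2 a4
          linarith
        · have := ((hS (x z).fst).sub_const (S (x z).fst)).pow 2
          simpa using this
      have := hsq.sqrt
      simpa using this
    -- The first components converge in norm: `h1` compares T_k(φ_k) with T_k(x) by the contraction
    -- property, and `h2` compares T_k(x) with S(x) by dominated convergence.
    have h3 : Tendsto (fun k => ‖J (X k) - l‖) atTop (𝓝 0) := by
      have h4 : Tendsto (fun k => ‖J (hφ k).jet - J x‖) atTop (𝓝 0) := by
        have := (((J.continuous.tendsto x).comp hlim).sub_const (J x)).norm
        simpa using this
      refine squeeze_zero (fun k => norm_nonneg _) (fun k => ?_) (by simpa using h4.add h2)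
      exact (norm_sub_le_norm_sub_add_norm_sub _ (g k).toLp _).trans
        (add_le_add_left (h1 k) _)
    have h5 : J y = l := by
      refine sub_eq_zero.1 (norm_le_zero_iff.1 (le_of_forall_pos_le_add fun ε hε => ?_))
      obtain ⟨c1, c2⟩ := closedBall_preimage_convex (T := J) l ε
      have := hy _ c1 c2 ((h3.eventually_le_const hε))
      simpa using this
    have h6 := JetCoeff.fstCoeff.coeFn_op y
    rw [← hJ, h5] at h6
    filter_upwards [h6, (hmem S hSm hSle).coeFn_toLp] with z e1 e2
    rw [e2] at e1
    have := congrArg (fun w : JetValue => w.fst) e1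
    simpa [JetCoeff.fstCoeff] using this.symm
  · intro W hW
    refine le_of_forall_pos_le_add fun ε hε => ?_
    obtain ⟨c1, c2⟩ := closedBall_preimage_convex (T := W.op) 0 (‖W.op x‖ + ε)
    have hW' := (((W.op.continuous.tendsto x).comp hlim).norm).eventually_le_const
      (lt_add_of_pos_right ‖W.op x‖ hε)
    have := hy _ c1 c2 (by
      filter_upwards [hW'] with k hk
      simpa using (hop W hW k).trans hk)
    simpa using this

/-- A smooth approximation of the absolute value. -/
def smoothAbs (k : ℕ) (s : ℝ) : ℝ := √(s ^ 2 + (1 / ((k : ℝ) + 1)) ^ 2)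

theorem smoothAbs_pos_aux (k : ℕ) (s : ℝ) : 0 < s ^ 2 + (1 / ((k : ℝ) + 1)) ^ 2 := by
  positivity

theorem contDiff_smoothAbs (k : ℕ) : ContDiff ℝ ∞ (smoothAbs k) :=
  ((contDiff_id.pow 2).add contDiff_const).sqrt fun s => (smoothAbs_pos_aux k s).ne'

theorem smoothAbs_neg (k : ℕ) (s : ℝ) : smoothAbs k (-s) = smoothAbs k s := by
  rw [smoothAbs, smoothAbs, neg_sq]

theorem abs_deriv_smoothAbs_le (k : ℕ) (s : ℝ) : |deriv (smoothAbs k) s| ≤ 1 := by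
  have h : HasDerivAt (smoothAbs k) (2 * s / (2 * smoothAbs k s)) s := by
    have := (((hasDerivAt_id s).pow 2).add_const ((1 / ((k : ℝ) + 1)) ^ 2)).sqrt
      (smoothAbs_pos_aux k s).ne'
    have e : smoothAbs k = fun s => √(s ^ 2 + (1 / ((k : ℝ) + 1)) ^ 2) := rfl
    rw [e]
    simpa using this
  have hpos : 0 < smoothAbs k s := Real.sqrt_pos.2 (smoothAbs_pos_aux k s)
  rw [h.deriv, mul_div_mul_left _ _ two_ne_zero, abs_div, abs_of_pos hpos, div_le_one hpos]
  refine Real.abs_le_sqrt ?_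
  have : 0 ≤ (1 / ((k : ℝ) + 1)) ^ 2 := by positivity
  linarith

theorem tendsto_smoothAbs (s : ℝ) : Tendsto (fun k => smoothAbs k s) atTop (𝓝 |s|) := by
  have h := (((tendsto_one_div_add_atTop_nhds_zero_nat (𝕜 := ℝ)).pow 2).const_add (s ^ 2)).sqrt
  simpa [smoothAbs, Real.sqrt_sq_eq_abs] using h

theorem abs_smoothAbs_sub_le (k : ℕ) (s t : ℝ) : |smoothAbs k s - smoothAbs k t| ≤ |s - t| := by
  have h := Convex.norm_image_sub_le_of_norm_deriv_le (s := univ) (C := 1) (f := smoothAbs k)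
    (x := t) (y := s) (fun r _ => (contDiff_smoothAbs k).differentiable (by simp) r)
    (fun r _ => abs_deriv_smoothAbs_le k r) convex_univ (mem_univ _) (mem_univ _)
  simpa using h

/-- The truncation of real numbers to the interval `[-γ, γ]`. -/
def clamp (γ s : ℝ) : ℝ := (|s + γ| - |s - γ|) / 2

theorem clamp_of_abs_le {γ s : ℝ} (h : |s| ≤ γ) : clamp γ s = s := by
  obtain ⟨h1, h2⟩ := abs_le.1 h
  rw [clamp, abs_of_nonneg (by linarith), abs_of_nonpos (by linarith)]
  ring

theorem abs_sub_clamp_le {γ δ s : ℝ} (hγ : 0 ≤ γ) (hδ : 0 ≤ δ) (h : |s| ≤ γ + δ) :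
    |s - clamp γ s| ≤ δ := by
  obtain ⟨h1, h2⟩ := abs_le.1 h
  rw [clamp, abs_le]
  rcases abs_cases (s + γ) with ⟨e1, _⟩ | ⟨e1, _⟩ <;>
    rcases abs_cases (s - γ) with ⟨e2, _⟩ | ⟨e2, _⟩ <;> rw [e1, e2] <;>
    constructor <;> linarith

/-- The derivative is half the difference of two numbers in [-1, 1], and evenness of `smoothAbs`
makes the map fix the origin. -/
theorem isSmoothContraction_clamp (γ : ℝ) (k : ℕ) :
    IsSmoothContraction fun s => (smoothAbs k (s + γ) - smoothAbs k (s - γ)) / 2 := by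
  refine ⟨?_, ?_, fun s => ?_⟩
  · exact (((contDiff_smoothAbs k).comp (contDiff_id.add contDiff_const)).sub
      ((contDiff_smoothAbs k).comp (contDiff_id.sub contDiff_const))).div_const 2
  · rw [zero_add, zero_sub, smoothAbs_neg, sub_self, zero_div]
  · have hd : ∀ r, HasDerivAt (smoothAbs k) (deriv (smoothAbs k) r) r := fun r =>
      ((contDiff_smoothAbs k).differentiable (by simp) r).hasDerivAt
    have h := (((hd (s + γ)).comp_add_const s γ).sub ((hd (s - γ)).comp_sub_const s γ)).div_const 2
    have h' := h.deriv
    simp only [Pi.sub_apply] at h'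
    rw [h', abs_div, abs_two, div_le_one two_pos]
    refine (abs_sub _ _).trans ?_
    linarith [abs_deriv_smoothAbs_le k (s + γ), abs_deriv_smoothAbs_le k (s - γ)]

/-- A smooth version of min(s, 0) = (s − |s|)/2; the term `smoothAbs k 0` is there to make the map
fix the origin exactly. -/
theorem isSmoothContraction_min_zero (k : ℕ) :
    IsSmoothContraction fun s => (s - (smoothAbs k s - smoothAbs k 0)) / 2 := by
  refine ⟨?_, ?_, fun s => ?_⟩
  · exact (contDiff_id.sub ((contDiff_smoothAbs k).sub contDiff_const)).div_const 2
  · simp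
  · have hd := ((contDiff_smoothAbs k).differentiable (by simp) s).hasDerivAt
    have h := ((hasDerivAt_id s).sub (hd.sub_const (smoothAbs k 0))).div_const 2
    have h' := h.deriv
    simp only [Pi.sub_apply, id] at h'
    rw [h', abs_div, abs_two, div_le_one two_pos]
    refine (abs_sub _ _).trans ?_
    rw [abs_one]
    linarith [abs_deriv_smoothAbs_le k s]

/-- The jets of the test functions on `O` with values in `[-γ, γ]`. -/
def boundedTestJets (O : Set Plane) (γ : ℝ) : Set JetSpace :=
  {f | ∃ φ, ∃ h : IsTestFunction O φ, (∀ y, |φ y| ≤ γ) ∧ h.jet = f}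

theorem convex_boundedTestJets (O : Set Plane) (γ : ℝ) : Convex ℝ (boundedTestJets O γ) := by
  rintro _ ⟨φ, hφ, hφγ, rfl⟩ _ ⟨ψ, hψ, hψγ, rfl⟩ s t hs ht hst
  refine ⟨_, (hφ.const_mul s).add (hψ.const_mul t), fun y => ?_, ?_⟩
  · refine (abs_add_le _ _).trans ?_
    rw [abs_mul, abs_mul, abs_of_nonneg hs, abs_of_nonneg ht]
    have h1 := mul_le_mul_of_nonneg_left (hφγ y) hs
    have h2 := mul_le_mul_of_nonneg_left (hψγ y) ht
    calc _ ≤ (s + t) * γ := by linarith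
      _ = γ := by rw [hst, one_mul]
  · rw [(hφ.const_mul s).jet_add (hψ.const_mul t), hφ.jet_const_mul, hψ.jet_const_mul]

/-- The smooth truncations take values in [-γ, γ], since `smoothAbs` is 1-Lipschitz and its two
arguments differ by 2γ. Test functions composed with them therefore obey the bound, and the set of
their jets is convex, so its closure contains the weak limit. -/
theorem exists_clamp_mem {O : Set Plane} {x : JetSpace} (hx : x ∈ zeroTraceJets O) {γ : ℝ}
    (hγ : 0 ≤ γ) : ∃ y ∈ zeroTraceJets O, (∀ᵐ z, (y z).fst = clamp γ (x z).fst) ∧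
      y ∈ closure (boundedTestJets O γ) := by
  obtain ⟨y, hy, h1, -, h3⟩ := exists_comp_mem_zeroTraceJets hx (isSmoothContraction_clamp γ)
    (S := clamp γ) fun s => ((tendsto_smoothAbs (s + γ)).sub (tendsto_smoothAbs (s - γ))).div_const 2
  refine ⟨y, hy, h1, h3 _ isClosed_closure (convex_boundedTestJets O γ).closure ?_⟩
  intro k φ hφ
  refine subset_closure ⟨_, (isSmoothContraction_clamp γ k).comp hφ, fun z => ?_, rfl⟩
  rw [abs_div, abs_two, div_le_iff₀ two_pos]
  refine (abs_smoothAbs_sub_le k _ _).trans ?_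
  rw [add_sub_sub_cancel, abs_of_nonneg (by linarith)]
  linarith

/-- Bounded members of `H¹₀(O)` are limits of test functions with the same bound. -/
theorem mem_closure_boundedTestJets {O : Set Plane} {x : JetSpace} (hx : x ∈ zeroTraceJets O)
    {γ : ℝ} (hγ : 0 ≤ γ) (h : ∀ᵐ z, |(x z).fst| ≤ γ) : x ∈ closure (boundedTestJets O γ) := by
  obtain ⟨y, hy, h1, h2⟩ := exists_clamp_mem hx hγ
  have e : x = y := eq_of_fst_ae_eq hx hy (by
    filter_upwards [h, h1] with z a b
    rw [b, clamp_of_abs_le a])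
  rwa [e]

theorem exists_min_zero_mem {O : Set Plane} {x : JetSpace} (hx : x ∈ zeroTraceJets O) :
    ∃ y ∈ zeroTraceJets O, (∀ᵐ z, (y z).fst = min (x z).fst 0) ∧
      ∀ W : JetCoeff, W.w = 0 → ‖W.op y‖ ≤ ‖W.op x‖ := by
  obtain ⟨y, hy, h1, h2, -⟩ := exists_comp_mem_zeroTraceJets hx isSmoothContraction_min_zero
    (S := fun s => min s 0) fun s => by
      have h := ((tendsto_const_nhds (x := s)).sub
        ((tendsto_smoothAbs s).sub (tendsto_smoothAbs 0))).div_const 2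
      rw [abs_zero, sub_zero] at h
      refine h.trans (le_of_eq (congrArg 𝓝 ?_))
      rcases le_total s 0 with hs | hs
      · rw [abs_of_nonpos hs, min_eq_left hs]; ring
      · rw [abs_of_nonneg hs, min_eq_right hs]; ring
  exact ⟨y, hy, h1, h2⟩

/-! ### Localization and inward translation -/

/-- Multiplication of jets by a test function. -/
def IsTestFunction.mulOp {O : Set Plane} {θ : Plane → ℝ} (h : IsTestFunction O θ) :
    JetSpace →L[ℝ] JetSpace :=
  (JetCoeff.ofSmooth h.smooth h.exists_bound.choose_spec.1 h.exists_bound.choose_spec.2).op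

theorem IsTestFunction.fst_mulOp {O : Set Plane} {θ : Plane → ℝ} (h : IsTestFunction O θ)
    (x : JetSpace) : ∀ᵐ z, (h.mulOp x z).fst = θ z * (x z).fst := by
  filter_upwards [JetCoeff.coeFn_op (JetCoeff.ofSmooth h.smooth h.exists_bound.choose_spec.1
    h.exists_bound.choose_spec.2) x] with z hz
  rw [mulOp, hz]
  rfl

theorem IsTestFunction.mulOp_mem {O O' : Set Plane} {θ : Plane → ℝ} (h : IsTestFunction O θ)
    {x : JetSpace} (hx : x ∈ zeroTraceJets O') : h.mulOp x ∈ zeroTraceJets O := by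
  refine zeroTraceJets_induction _ (isClosed_zeroTraceJets O) (fun φ hφ => ?_) hx
  have hθφ : IsTestFunction O (fun x => θ x * φ x) := by
    have := h.mul_of_smooth hφ.smooth
    simpa only [mul_comm] using this
  rw [mulOp, JetCoeff.op_ofSmooth_jet _ _ _ hφ hθφ]
  exact hθφ.jet_mem

/-- Translation of the plane. -/
def translation (s : Plane) : C(Plane, Plane) := ⟨fun y => y - s, by fun_prop⟩

theorem measurePreserving_translation (s : Plane) :
    MeasurePreserving (translation s) volume volume := measurePreserving_sub_right volume s

/-- Translation of jets. -/
def translateOp (s : Plane) : JetSpace →L[ℝ] JetSpace :=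
  (Lp.compMeasurePreservingₗᵢ ℝ (translation s)
    (measurePreserving_translation s)).toContinuousLinearMap

theorem coeFn_translateOp (s : Plane) (x : JetSpace) :
    translateOp s x =ᵐ[volume] fun y => x (y - s) :=
  Lp.coeFn_compMeasurePreserving x (measurePreserving_translation s)

theorem tendsto_translateOp (n : Plane) (x : JetSpace) :
    Tendsto (fun t : ℝ => translateOp (t • n) x) (𝓝[>] 0) (𝓝 x) := by
  have hc : Continuous fun t : ℝ => translation (t • n) :=
    ContinuousMap.continuous_of_continuous_uncurry _ (by
      simp only [Function.uncurry_def, translation]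
      exact continuous_snd.sub (continuous_fst.smul continuous_const))
  have h := Tendsto.compMeasurePreservingLp (tendsto_const_nhds (x := x))
    ((hc.tendsto 0).mono_left (nhdsWithin_le_nhds (s := Ioi (0 : ℝ))))
    (fun t => measurePreserving_translation (t • n)) (measurePreserving_translation _)
    (ENNReal.ofNat_ne_top)
  have e : Lp.compMeasurePreserving (translation ((0 : ℝ) • n))
      (measurePreserving_translation _) x = x := by
    refine Lp.ext ?_
    filter_upwards [Lp.coeFn_compMeasurePreserving x
      (measurePreserving_translation ((0 : ℝ) • n))] with y hy
    rw [hy]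
    simp [translation]
  rw [e] at h
  exact h

theorem translateOp_mem {x : JetSpace} (s : Plane) (hx : x ∈ zeroTraceJets univ) :
    translateOp s x ∈ zeroTraceJets univ := by
  refine zeroTraceJets_induction _ (isClosed_zeroTraceJets univ) (fun φ hφ => ?_) hx
  have e : translateOp s hφ.jet = (hφ.translate s).jet := by
    refine Lp.ext ?_
    filter_upwards [coeFn_translateOp s hφ.jet, (hφ.translate s).coeFn_jet,
      (measurePreserving_translation s).quasiMeasurePreserving.ae hφ.coeFn_jet] with y e1 e2 e3
    rw [e1, e2]
    refine Eq.trans e3 (JetValue.ext rfl ?_)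
    exact (hφ.smooth.hasGradientAt (y - s)).comp_translate.gradient.symm
  rw [e]
  exact (hφ.translate s).jet_mem

/-- Near each of its boundary points, the closure of `U` can be pushed into `U` by arbitrarily
small translations. -/
def HasInwardTranslations (U : Set Plane) : Prop :=
  ∀ x ∈ frontier U, ∃ n : Plane, ∃ N ∈ 𝓝 x, ∀ᶠ t : ℝ in 𝓝[>] 0, ∀ y ∈ N ∩ closure U, y + t • n ∈ U

/-- A cutoff that is one near K leaves x unchanged, and multiplication by it maps into H¹₀(O). -/
theorem mem_zeroTraceJets_of_compact {O K : Set Plane} (hO : IsOpen O) (hK : IsCompact K)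
    (hKO : K ⊆ O) {x : JetSpace} (hx : x ∈ zeroTraceJets univ)
    (h0 : ∀ᵐ z, z ∉ K → (x z).fst = 0) : x ∈ zeroTraceJets O := by
  obtain ⟨χ, hχ, h1, -⟩ := exists_cutoff hK hO hKO
  have e : x = hχ.mulOp x := eq_of_fst_ae_eq hx (hχ.mulOp_mem hx) (by
    filter_upwards [hχ.fst_mulOp x, h0] with z e1 e2
    rw [e1]
    by_cases hz : z ∈ K
    · rw [h1.self_of_nhdsSet z hz, one_mul]
    · rw [e2 hz, mul_zero])
  rw [e]
  exact hχ.mulOp_mem hx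

/-- The product θx lives on the compact set tsupport θ ∩ closure U. A small translation along n
pushes that set into Ω ∩ U, and the translates converge to θx as t tends to 0. -/
theorem mulOp_mem_of_inward {Ω U N : Set Plane} (hΩ : IsOpen Ω) (hU : IsOpen U) {n : Plane}
    (hN : ∀ᶠ t : ℝ in 𝓝[>] 0, ∀ y ∈ N ∩ closure U, y + t • n ∈ U) {θ : Plane → ℝ}
    (hθ : IsTestFunction (N ∩ Ω) θ) {x : JetSpace} (hx : x ∈ zeroTraceJets Ω)
    (h0 : ∀ᵐ z, z ∉ U → (x z).fst = 0) : hθ.mulOp x ∈ zeroTraceJets (Ω ∩ U) := by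
  have hg : hθ.mulOp x ∈ zeroTraceJets univ :=
    zeroTraceJets_mono (subset_univ _) (hθ.mulOp_mem hx)
  refine (isClosed_zeroTraceJets (Ω ∩ U)).mem_of_tendsto (tendsto_translateOp n _) ?_
  have hK : IsCompact (tsupport θ ∩ closure U) :=
    hθ.compact.isCompact.inter_right isClosed_closure
  obtain ⟨δ, hδ, hδΩ⟩ := hθ.compact.isCompact.exists_thickening_subset_open hΩ
    (hθ.support_subset.trans inter_subset_right)
  have hsmall : ∀ᶠ t : ℝ in 𝓝[>] 0, ‖t • n‖ < δ := by
    have hc : Continuous fun t : ℝ => ‖t • n‖ := by fun_prop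
    have := (hc.tendsto 0).mono_left (nhdsWithin_le_nhds (s := Ioi 0))
    exact this.eventually_lt_const (by simpa using hδ)
  filter_upwards [hN, hsmall] with t h1 h2
  refine mem_zeroTraceJets_of_compact (hΩ.inter hU)
    (hK.image (continuous_id.add continuous_const : Continuous fun y => y + t • n)) ?_
    (translateOp_mem _ hg) ?_
  · rintro _ ⟨y, ⟨hy1, hy2⟩, rfl⟩
    refine ⟨hδΩ (Metric.mem_thickening_iff.2 ⟨y, hy1, ?_⟩),
      h1 y ⟨(hθ.support_subset hy1).1, hy2⟩⟩
    simpa [dist_eq_norm] using h2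
  · filter_upwards [coeFn_translateOp (t • n) (hθ.mulOp x),
      (measurePreserving_translation (t • n)).quasiMeasurePreserving.ae (hθ.fst_mulOp x),
      (measurePreserving_translation (t • n)).quasiMeasurePreserving.ae h0] with z e1 e2 e3 hz
    rw [e1]
    refine Eq.trans e2 ?_
    change θ (z - t • n) * (x (z - t • n)).fst = 0
    by_cases hzθ : z - t • n ∈ tsupport θ
    · rw [show (x (z - t • n)).fst = 0 from
        e3 fun hzU => hz ⟨z - t • n, ⟨hzθ, subset_closure hzU⟩, sub_add_cancel z _⟩, mul_zero]
    · rw [image_eq_zero_of_notMem_tsupport hzθ, zero_mul]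

/-- As 1 − θ vanishes near the frontier, 1_U(1 − θ) is smooth, and its product with a test function
on Ω is compactly supported in Ω ∩ U. For x vanishing off U, this factor acts like 1 − θ. -/
theorem sub_mulOp_mem {Ω U : Set Plane} (hU : IsOpen U) {θ : Plane → ℝ} (hθ : IsTestFunction Ω θ)
    (h1 : ∀ᶠ z in 𝓝ˢ (frontier U), θ z = 1) {x : JetSpace} (hx : x ∈ zeroTraceJets Ω)
    (h0 : ∀ᵐ z, z ∉ U → (x z).fst = 0) : x - hθ.mulOp x ∈ zeroTraceJets (Ω ∩ U) := by
  set η : Plane → ℝ := U.indicator fun z => 1 - θ z with hη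
  have hloc : ∀ z, (z ∈ U ∧ η =ᶠ[𝓝 z] fun z => 1 - θ z) ∨ (z ∉ U ∧ η =ᶠ[𝓝 z] fun _ => 0) := by
    intro z
    by_cases hz : z ∈ U
    · refine Or.inl ⟨hz, ?_⟩
      filter_upwards [hU.mem_nhds hz] with y hy
      rw [hη, indicator_of_mem hy]
    · refine Or.inr ⟨hz, ?_⟩
      by_cases hzc : z ∈ closure U
      · have hzf : z ∈ frontier U := ⟨hzc, by rwa [hU.interior_eq]⟩
        filter_upwards [eventually_nhdsSet_iff_forall.1 h1 z hzf] with y hy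
        rw [hη]
        by_cases hyU : y ∈ U
        · rw [indicator_of_mem hyU, hy, sub_self]
        · rw [indicator_of_notMem hyU]
      · filter_upwards [isClosed_closure.isOpen_compl.mem_nhds hzc] with y hy
        rw [hη, indicator_of_notMem fun h => hy (subset_closure h)]
  have hsm : ContDiff ℝ ∞ (fun z => 1 - θ z) := contDiff_const.sub hθ.smooth
  have hηs : ContDiff ℝ ∞ η := contDiff_iff_contDiffAt.2 fun z => by
    rcases hloc z with ⟨-, h⟩ | ⟨-, h⟩
    · exact hsm.contDiffAt.congr_of_eventuallyEq h
    · exact contDiffAt_const.congr_of_eventuallyEq h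
  obtain ⟨C, hC0, hC1⟩ := hθ.exists_bound
  have hCnn : 0 ≤ C := (abs_nonneg _).trans (hC0 0)
  have hη0 : ∀ z, |η z| ≤ 1 + C := fun z => by
    rcases hloc z with ⟨-, h⟩ | ⟨-, h⟩
    · rw [h.eq_of_nhds]
      refine (abs_sub _ _).trans ?_
      rw [abs_one]; linarith [hC0 z]
    · rw [h.eq_of_nhds, abs_zero]; linarith
  have hη1 : ∀ z, ‖∇ η z‖ ≤ 1 + C := fun z => by
    rcases hloc z with ⟨-, h⟩ | ⟨-, h⟩
    · have hg : ∇ (fun z => 1 - θ z) z = -∇ θ z := by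
        have := (hasGradientAt_const z (1 : ℝ)).add_fun
          ((hasGradientAt_const z (-1 : ℝ)).mul_fun (hθ.smooth.hasGradientAt z))
        simpa [sub_eq_add_neg] using this.gradient
      rw [h.gradient_eq, hg, norm_neg]; linarith [hC1 z]
    · rw [h.gradient_eq, gradient_fun_const, norm_zero]; linarith
  have hηφ : ∀ φ, IsTestFunction Ω φ → IsTestFunction (Ω ∩ U) fun z => η z * φ z := by
    intro φ hφ
    refine IsTestFunction.of_tsupport_subset (K := tsupport φ ∩ tsupport η) (hηs.mul hφ.smooth)
      (hφ.compact.isCompact.inter_right (isClosed_tsupport η)) ?_ ?_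
    · rintro z ⟨hz1, hz2⟩
      refine ⟨hφ.support_subset hz1, ?_⟩
      rcases hloc z with ⟨h, -⟩ | ⟨-, h⟩
      · exact h
      · exact absurd hz2 (notMem_tsupport_iff_eventuallyEq.2 h)
    · intro z hz
      by_cases hzφ : z ∈ tsupport φ
      · rw [image_eq_zero_of_notMem_tsupport fun h => hz ⟨hzφ, h⟩, zero_mul]
      · rw [image_eq_zero_of_notMem_tsupport hzφ, mul_zero]
  have hmem : (JetCoeff.ofSmooth hηs hη0 hη1).op x ∈ zeroTraceJets (Ω ∩ U) := by
    refine zeroTraceJets_induction _ (isClosed_zeroTraceJets _) (fun φ hφ => ?_) hx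
    rw [JetCoeff.op_ofSmooth_jet _ _ _ hφ (hηφ φ hφ)]
    exact (hηφ φ hφ).jet_mem
  have e : x - hθ.mulOp x = (JetCoeff.ofSmooth hηs hη0 hη1).op x := by
    refine eq_of_fst_ae_eq ((zeroTraceJets Ω).sub_mem hx (hθ.mulOp_mem hx)) hmem ?_
    filter_upwards [Lp.coeFn_sub x (hθ.mulOp x), hθ.fst_mulOp x, h0,
      JetCoeff.coeFn_op (JetCoeff.ofSmooth hηs hη0 hη1) x] with z e1 e2 e3 e4
    rw [e1, e4, JetCoeff.act_fst, Pi.sub_apply, WithLp.sub_fst, e2]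
    change _ = η z * _
    by_cases hz : z ∈ U
    · rw [hη, indicator_of_mem hz]; ring
    · rw [e3 hz]; ring
  rw [e]
  exact hmem

/-- A member of `H¹₀(Ω)` that vanishes off a regular open set `U` belongs to `H¹₀(Ω ∩ U)`. -/
theorem mem_zeroTraceJets_inter {Ω U : Set Plane} (hΩ : IsOpen Ω) (hU : IsOpen U)
    (hUc : IsCompact (frontier U)) (hUΩ : frontier U ⊆ Ω) (hin : HasInwardTranslations U)
    {x : JetSpace} (hx : x ∈ zeroTraceJets Ω) (h0 : ∀ᵐ z, z ∉ U → (x z).fst = 0) :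
    x ∈ zeroTraceJets (Ω ∩ U) := by
  -- Compactness induction over the frontier replaces a partition of unity: the property of a set is
  -- that some cutoff, one near it, multiplies into H¹₀(Ω ∩ U).
  have key : ∃ θ, ∃ hθ : IsTestFunction Ω θ, (∀ᶠ z in 𝓝ˢ (frontier U), θ z = 1) ∧
      ∀ y ∈ zeroTraceJets Ω, (∀ᵐ z, z ∉ U → (y z).fst = 0) →
        hθ.mulOp y ∈ zeroTraceJets (Ω ∩ U) := by
    refine hUc.induction_on (p := fun s => ∃ θ, ∃ hθ : IsTestFunction Ω θ,
      (∀ᶠ z in 𝓝ˢ s, θ z = 1) ∧ ∀ y ∈ zeroTraceJets Ω, (∀ᵐ z, z ∉ U → (y z).fst = 0) →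
        hθ.mulOp y ∈ zeroTraceJets (Ω ∩ U)) ?_ ?_ ?_ ?_
    · refine ⟨_, IsTestFunction.zero Ω, by simp, fun y hy _ => ?_⟩
      have e : (IsTestFunction.zero Ω).mulOp y = 0 :=
        eq_of_fst_ae_eq ((IsTestFunction.zero Ω).mulOp_mem hy) (zeroTraceJets Ω).zero_mem (by
          filter_upwards [(IsTestFunction.zero Ω).fst_mulOp y,
            Lp.coeFn_zero JetValue 2 (volume : Measure Plane)] with z e1 e2
          rw [e1, e2, zero_mul]; rfl)
      rw [e]
      exact Submodule.zero_mem _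
    · rintro s t hst ⟨θ, hθ, h1, h2⟩
      exact ⟨θ, hθ, h1.filter_mono (nhdsSet_mono hst), h2⟩
    · rintro s t ⟨θ, hθ, h1, h2⟩ ⟨η, hη, h3, h4⟩
      -- The cutoff for the union is 1 − (1 − θ)(1 − η), and its product with y is θy + η(y − θy),
      -- so the two hypotheses apply in turn.
      have hζ := hθ.add ((hη.add ((hη.mul_of_smooth hθ.smooth).const_mul (-1))))
      refine ⟨_, hζ, ?_, fun y hy hy0 => ?_⟩
      · rw [nhdsSet_union, eventually_sup]
        constructor
        · filter_upwards [h1] with z hz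
          rw [hz]; ring
        · filter_upwards [h3] with z hz
          rw [hz]; ring
      · have hy' : y - hθ.mulOp y ∈ zeroTraceJets Ω :=
          (zeroTraceJets Ω).sub_mem hy (hθ.mulOp_mem hy)
        have hf : ∀ᵐ z, ((y - hθ.mulOp y) z).fst = (y z).fst - θ z * (y z).fst := by
          filter_upwards [Lp.coeFn_sub y (hθ.mulOp y), hθ.fst_mulOp y] with z e1 e2
          rw [e1, Pi.sub_apply, WithLp.sub_fst, e2]
        have hm := (zeroTraceJets (Ω ∩ U)).add_mem (h2 y hy hy0) (h4 _ hy' (by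
          filter_upwards [hf, hy0] with z e1 e2 hz
          rw [e1, e2 hz]; ring))
        have e : hζ.mulOp y = hθ.mulOp y + hη.mulOp (y - hθ.mulOp y) :=
          eq_of_fst_ae_eq (hζ.mulOp_mem hy) hm (by
            filter_upwards [Lp.coeFn_add (hθ.mulOp y) (hη.mulOp (y - hθ.mulOp y)),
              hζ.fst_mulOp y, hθ.fst_mulOp y, hη.fst_mulOp (y - hθ.mulOp y), hf]
              with z e1 e2 e3 e4 e5
            rw [e1, e2, Pi.add_apply, WithLp.add_fst, e3, e4, e5]; ring)
        rw [e]
        exact hm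
    · intro z hz
      obtain ⟨n, N, hN, hn⟩ := hin z hz
      obtain ⟨θ, hθ, h1, -⟩ := exists_cutoff (isCompact_singleton (x := z))
        (isOpen_interior.inter hΩ) (singleton_subset_iff.2 ⟨mem_interior_iff_mem_nhds.2 hN, hUΩ hz⟩)
      rw [nhdsSet_singleton] at h1
      obtain ⟨t, ht, hto, hzt⟩ := eventually_nhds_iff.1 h1
      refine ⟨t, mem_nhdsWithin_of_mem_nhds (hto.mem_nhds hzt), θ, hθ.mono inter_subset_right,
        ?_, fun y hy hy0 => ?_⟩
      · rw [hto.nhdsSet_eq]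
        exact eventually_principal.2 ht
      · exact mulOp_mem_of_inward hΩ hU hn
          (hθ.mono (inter_subset_inter_left _ interior_subset)) hy hy0
  obtain ⟨θ, hθ, h1, h2⟩ := key
  have := (zeroTraceJets (Ω ∩ U)).add_mem (h2 x hx h0) (sub_mulOp_mem hU hθ h1 hx h0)
  rwa [add_sub_cancel] at this

/-! ### Regularity of the boundary and shape of the step weight -/

/-- A smooth function increases in the direction of its gradient, uniformly near a point. -/
theorem eventually_lt_add_smul_gradient {ρ : Plane → ℝ} (hρ : ContDiff ℝ ∞ ρ) {x : Plane}
    (hx : ∇ ρ x ≠ 0) : ∃ N ∈ 𝓝 x, ∀ᶠ t : ℝ in 𝓝[>] 0, ∀ y ∈ N,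
      ρ y < ρ (y + t • ∇ ρ x) ∧ ρ (y - t • ∇ ρ x) < ρ y := by
  set n := ∇ ρ x with hn
  have hnpos : 0 < ‖n‖ := norm_pos_iff.2 hx
  have hs : HasStrictFDerivAt ρ (fderiv ℝ ρ x) x :=
    hρ.contDiffAt.hasStrictFDerivAt (by simp)
  have ho := hs.isLittleO.def (half_pos hnpos)
  rw [Metric.eventually_nhds_iff] at ho
  obtain ⟨δ, hδ, ho⟩ := ho
  refine ⟨Metric.ball x (δ / 2), Metric.ball_mem_nhds x (half_pos hδ), ?_⟩
  have hsmall : ∀ᶠ t : ℝ in 𝓝[>] 0, ‖t • n‖ < δ / 2 := by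
    have hc : Continuous fun t : ℝ => ‖t • n‖ := by fun_prop
    have := (hc.tendsto 0).mono_left (nhdsWithin_le_nhds (s := Ioi 0))
    exact this.eventually_lt_const (by simpa using half_pos hδ)
  -- Strict differentiability with error ‖n‖/2 gives ρ z − ρ w ≥ t‖n‖² − t‖n‖²/2 > 0.
  have key : ∀ {t : ℝ} {z w : Plane}, 0 < t → z - w = t • n → dist z x < δ → dist w x < δ →
      ρ w < ρ z := by
    intro t z w ht hzw hz hw
    have h := ho (y := (z, w)) (by rw [Prod.dist_eq]; exact max_lt hz hw)
    simp only at h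
    rw [hzw, map_smul, ← inner_gradient_left, ← hn, real_inner_self_eq_norm_sq, norm_smul,
      Real.norm_eq_abs, Real.norm_eq_abs, abs_of_pos ht, smul_eq_mul] at h
    have h' := (abs_le.1 h).1
    have : 0 < t * ‖n‖ ^ 2 := by positivity
    nlinarith
  filter_upwards [hsmall, self_mem_nhdsWithin] with t ht ht0 y hy
  have hy' : dist y x < δ / 2 := hy
  have h1 : dist (y + t • n) y = ‖t • n‖ := by simp
  have h2 : dist (y - t • n) y = ‖t • n‖ := by simp
  have t1 := dist_triangle (y + t • n) y x
  have t2 := dist_triangle (y - t • n) y x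
  exact ⟨key ht0 (by abel) (by linarith) (by linarith),
    key ht0 (by abel) (by linarith) (by linarith)⟩

theorem le_zero_of_mem_closure {S N : Set Plane} {ρ : Plane → ℝ} (hρ : Continuous ρ)
    (hN : ∀ y ∈ N, (y ∈ S ↔ ρ y < 0)) {y : Plane} (hyN : y ∈ interior N) (hy : y ∈ closure S) :
    ρ y ≤ 0 := by
  by_contra h
  push Not at h
  obtain ⟨z, ⟨hz1, hz2⟩, hzS⟩ := mem_closure_iff.1 hy _
    (isOpen_interior.inter (isOpen_lt continuous_const hρ)) ⟨hyN, h⟩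
  exact lt_asymm ((hN z (interior_subset hz1)).1 hzS) hz2

theorem eventually_add_smul_mem {N : Set Plane} {x : Plane} (hN : N ∈ 𝓝 x) (n : Plane) :
    ∃ M ∈ 𝓝 x, ∀ᶠ t : ℝ in 𝓝[>] 0, ∀ y ∈ M, y + t • n ∈ N := by
  have hc : Continuous fun q : ℝ × Plane => q.2 + q.1 • n := by fun_prop
  have h := hc.tendsto (0, x)
  simp only [zero_smul, add_zero] at h
  have h' := h hN
  rw [mem_map, nhds_prod_eq, mem_prod_iff] at h'
  obtain ⟨T, hT, M, hM, hTM⟩ := h'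
  refine ⟨M, hM, ?_⟩
  filter_upwards [nhdsWithin_le_nhds hT] with t ht y hy
  exact hTM (mk_mem_prod ht hy)

/-- On the closure of S the local defining function is ≤ 0, and a step against its gradient makes it
negative. -/
theorem HasSmoothBoundary.hasInwardTranslations {S : Set Plane} (h : HasSmoothBoundary S) :
    HasInwardTranslations S := by
  intro x hx
  obtain ⟨N, hN, ρ, hρ, hne, hiff⟩ := h x hx
  obtain ⟨M, hM, h1⟩ := eventually_lt_add_smul_gradient hρ hne
  obtain ⟨M', hM', h2⟩ := eventually_add_smul_mem hN (-∇ ρ x)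
  refine ⟨-∇ ρ x, (M ∩ M') ∩ interior N,
    inter_mem (inter_mem hM hM') (interior_mem_nhds.2 hN), ?_⟩
  filter_upwards [h1, h2] with t h1 h2
  rintro y ⟨⟨⟨hy1, hy2⟩, hy3⟩, hy4⟩
  rw [hiff _ (h2 y hy2), smul_neg, ← sub_eq_add_neg]
  exact (h1 y hy1).2.trans_le (le_zero_of_mem_closure hρ.continuous hiff hy3 hy4)

theorem frontier_compl_closure_subset (S : Set Plane) : frontier (closure S)ᶜ ⊆ frontier S := by
  rw [frontier_compl]
  exact frontier_closure_subset

/-- Near the boundary the closure of the exterior lies in ρ ≥ 0, since S is open. A step along the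
gradient makes ρ positive, which is impossible on closure S. -/
theorem HasSmoothBoundary.hasInwardTranslations_compl {S : Set Plane} (hS : IsOpen S)
    (h : HasSmoothBoundary S) : HasInwardTranslations (closure S)ᶜ := by
  intro x hx
  obtain ⟨N, hN, ρ, hρ, hne, hiff⟩ := h x (frontier_compl_closure_subset S hx)
  obtain ⟨M, hM, h1⟩ := eventually_lt_add_smul_gradient hρ hne
  obtain ⟨M', hM', h2⟩ := eventually_add_smul_mem (interior_mem_nhds.2 hN) (∇ ρ x)
  refine ⟨∇ ρ x, (M ∩ M') ∩ N, inter_mem (inter_mem hM hM') hN, ?_⟩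
  filter_upwards [h1, h2] with t h1 h2
  rintro y ⟨⟨⟨hy1, hy2⟩, hy3⟩, hy4⟩ hcl
  have hyS : y ∉ S := by
    have := closure_mono (compl_subset_compl.2 (subset_closure (s := S))) hy4
    rwa [hS.isClosed_compl.closure_eq] at this
  have hy0 : 0 ≤ ρ y := not_lt.1 fun h => hyS ((hiff y hy3).2 h)
  have := le_zero_of_mem_closure hρ.continuous hiff (h2 y hy2) hcl
  linarith [(h1 y hy1).1]

/-- The step weight takes its larger value on an open set with regular boundary. -/
theorem exists_stepWeight_eq {S : Set Plane} (hS : IsOpen S) (h : HasSmoothBoundary S) {a : ℝ}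
    (ha : 0 < a) : ∃ (U : Set Plane) (b c : ℝ), IsOpen U ∧ HasInwardTranslations U ∧
      frontier U ⊆ frontier S ∧ 0 < b ∧ 0 ≤ c ∧
      ∀ x, stepWeight S a x = b + U.indicator (fun _ => c) x := by
  -- U is the side where p is larger: S if a ≤ 1, the exterior if a ≥ 1. The minimum prescribed on
  -- the interface makes p = b + c·1_U hold at every point.
  rcases le_total a 1 with h1 | h1
  · refine ⟨S, a, 1 - a, hS, h.hasInwardTranslations, Subset.rfl, ha, by linarith, fun x => ?_⟩
    by_cases hx : x ∈ S
    · rw [stepWeight, if_pos hx, indicator_of_mem hx]; ring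
    · rw [stepWeight, if_neg hx, indicator_of_notMem hx, min_eq_right h1, ite_self, add_zero]
  · refine ⟨(closure S)ᶜ, 1, a - 1, isClosed_closure.isOpen_compl,
      h.hasInwardTranslations_compl hS, frontier_compl_closure_subset S, one_pos, by linarith,
      fun x => ?_⟩
    by_cases hx : x ∈ S
    · rw [stepWeight, if_pos hx, indicator_of_notMem (notMem_compl_iff.2 (subset_closure hx)), add_zero]
    · rw [stepWeight, if_neg hx]
      have hfr : x ∈ frontier S ↔ x ∈ closure S := by
        rw [frontier, hS.interior_eq]; exact and_iff_left hx
      by_cases hx' : x ∈ closure S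
      · rw [if_pos (hfr.2 hx'), indicator_of_notMem (notMem_compl_iff.2 hx'), min_eq_left h1, add_zero]
      · rw [if_neg fun h => hx' (hfr.1 h), indicator_of_mem hx']; ring

/-! ### Approximation below the step function -/

/-- Members of `H¹₀(Ω)` bounded by a lower semicontinuous step function are limits of test
functions with the same pointwise bound. -/
theorem exists_seq_testFunction_le {Ω U : Set Plane} (hΩ : IsOpen Ω) (hU : IsOpen U)
    (hUc : IsCompact (frontier U)) (hUΩ : frontier U ⊆ Ω) (hin : HasInwardTranslations U)
    {β γ : ℝ} (hβ : 0 ≤ β) (hγ : 0 ≤ γ) {x : JetSpace} (hx : x ∈ zeroTraceJets Ω)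
    (hb : ∀ᵐ z, |(x z).fst| ≤ β + U.indicator (fun _ => γ) z) :
    ∃ (φ : ℕ → Plane → ℝ) (h : ∀ n, IsTestFunction Ω (φ n)),
      (∀ n z, |φ n z| ≤ β + U.indicator (fun _ => γ) z) ∧
      Tendsto (fun n => (h n).jet) atTop (𝓝 x) := by
  -- Here y is the truncation of x at β. The remainder x − y is bounded by γ and vanishes off U,
  -- where |x| ≤ β. It is approximated by test functions supported in Ω ∩ U, so the sum obeys the
  -- bound even on the frontier of U.
  obtain ⟨y, hy, hyx, hyc⟩ := exists_clamp_mem hx hβ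
  have hf : ∀ᵐ z, ((x - y) z).fst = (x z).fst - clamp β (x z).fst := by
    filter_upwards [Lp.coeFn_sub x y, hyx] with z e1 e2
    rw [e1, Pi.sub_apply, WithLp.sub_fst, e2]
  have hxy : x - y ∈ zeroTraceJets (Ω ∩ U) := by
    refine mem_zeroTraceJets_inter hΩ hU hUc hUΩ hin ((zeroTraceJets Ω).sub_mem hx hy) ?_
    filter_upwards [hf, hb] with z e1 e2 hz
    rw [indicator_of_notMem hz, add_zero] at e2
    rw [e1, clamp_of_abs_le e2, sub_self]
  have hxyc : x - y ∈ closure (boundedTestJets (Ω ∩ U) γ) := by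
    refine mem_closure_boundedTestJets hxy hγ ?_
    filter_upwards [hf, hb] with z e1 e2
    rw [e1]
    refine abs_sub_clamp_le hβ hγ (e2.trans ?_)
    gcongr
    exact indicator_le_self' (fun _ _ => hγ) z
  obtain ⟨f, hfm, hfl⟩ := mem_closure_iff_seq_limit.1 hyc
  obtain ⟨g, hgm, hgl⟩ := mem_closure_iff_seq_limit.1 hxyc
  choose φ hφ hφb hφe using hfm
  choose ψ hψ hψb hψe using hgm
  refine ⟨_, fun n => (hφ n).add ((hψ n).mono inter_subset_left), fun n z => ?_, ?_⟩
  · refine (abs_add_le _ _).trans (add_le_add (hφb n z) ?_)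
    by_cases hz : z ∈ U
    · rw [indicator_of_mem hz]; exact hψb n z
    · rw [indicator_of_notMem hz, (hψ n).eq_zero fun h => hz h.2, abs_zero]
  · have := hfl.add hgl
    rw [add_sub_cancel] at this
    refine this.congr fun n => ?_
    rw [IsTestFunction.jet_add (hφ n) ((hψ n).mono inter_subset_left), ← hφe n, ← hψe n]
    rfl

/-! ### Finite signed measures and test functions -/

theorem integrable_of_bounded {X : Type*} [MeasurableSpace X] {f : X → ℝ} (hf : Measurable f)
    {C : ℝ} (hC : ∀ x, |f x| ≤ C) (m : Measure X) [IsFiniteMeasure m] : Integrable f m :=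
  Integrable.of_bound hf.aestronglyMeasurable C (Eventually.of_forall hC)

/-- A difference of finite measures need not be the Jordan decomposition of the result. Moving
negative parts across turns the comparison into an identity of positive measures. -/
theorem jordan_add_eq {X : Type*} [MeasurableSpace X] {ν : SignedMeasure X} {m₁ m₂ : Measure X}
    [IsFiniteMeasure m₁] [IsFiniteMeasure m₂] (h : ν = m₁.toSignedMeasure - m₂.toSignedMeasure) :
    ν.toJordanDecomposition.posPart + m₂ = m₁ + ν.toJordanDecomposition.negPart := by
  rw [← Measure.toSignedMeasure_eq_toSignedMeasure_iff, Measure.toSignedMeasure_add,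
    Measure.toSignedMeasure_add, ← sub_eq_sub_iff_add_eq_add, ← h]
  exact SignedMeasure.toSignedMeasure_toJordanDecomposition ν

/-- The integral against a difference of finite measures. -/
theorem signedIntegral_sub {X : Type*} [MeasurableSpace X] (m₁ m₂ : Measure X)
    [IsFiniteMeasure m₁] [IsFiniteMeasure m₂] {f : X → ℝ} (hf : Measurable f) {C : ℝ}
    (hC : ∀ x, |f x| ≤ C) :
    signedIntegral (m₁.toSignedMeasure - m₂.toSignedMeasure) f = ∫ x, f x ∂m₁ - ∫ x, f x ∂m₂ := by
  have h := jordan_add_eq (rfl : m₁.toSignedMeasure - m₂.toSignedMeasure = _)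
  rw [signedIntegral, sub_eq_sub_iff_add_eq_add,
    ← integral_add_measure (integrable_of_bounded hf hC _) (integrable_of_bounded hf hC _), h,
    integral_add_measure (integrable_of_bounded hf hC _) (integrable_of_bounded hf hC _)]

theorem eq_jordan_sub {X : Type*} [MeasurableSpace X] (ν : SignedMeasure X) :
    ν = ν.toJordanDecomposition.posPart.toSignedMeasure -
      ν.toJordanDecomposition.negPart.toSignedMeasure :=
  (SignedMeasure.toSignedMeasure_toJordanDecomposition ν).symm

theorem totalVariation_toSignedMeasure {X : Type*} [MeasurableSpace X] (m : Measure X)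
    [IsFiniteMeasure m] : m.toSignedMeasure.totalVariation = m := by
  let j : JordanDecomposition X := ⟨m, 0, Measure.MutuallySingular.zero_right⟩
  have e : m.toSignedMeasure.toJordanDecomposition = j :=
    SignedMeasure.toJordanDecomposition_eq (by simp [JordanDecomposition.toSignedMeasure, j])
  rw [SignedMeasure.totalVariation, e]
  exact add_zero m

theorem abs_signedIntegral_le {X : Type*} [MeasurableSpace X] (ν : SignedMeasure X) {f g : X → ℝ}
    (hfg : ∀ x, |f x| ≤ g x) (hg : Measurable g) {C : ℝ} (hC : ∀ x, |g x| ≤ C) :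
    |signedIntegral ν f| ≤ ∫ x, g x ∂ν.totalVariation := by
  have hle : ∀ (m : Measure X) [IsFiniteMeasure m], |∫ x, f x ∂m| ≤ ∫ x, g x ∂m := by
    intro m _
    rw [← Real.norm_eq_abs]
    exact norm_integral_le_of_norm_le (integrable_of_bounded hg hC m) (Eventually.of_forall hfg)
  rw [SignedMeasure.totalVariation,
    integral_add_measure (integrable_of_bounded hg hC _) (integrable_of_bounded hg hC _)]
  exact (abs_sub _ _).trans (add_le_add (hle _) (hle _))

/-- The indicator of an open set is a limit of test functions. -/
theorem exists_seq_testFunction_tendsto_indicator {U : Set Plane} (hU : IsOpen U) :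
    ∃ φ : ℕ → Plane → ℝ, (∀ n, IsTestFunction U (φ n)) ∧ (∀ n x, φ n x ∈ Icc (0 : ℝ) 1) ∧
      ∀ x, Tendsto (fun n => φ n x) atTop (𝓝 (U.indicator 1 x)) := by
  have : LocallyCompactSpace U := hU.locallyCompactSpace
  let K := CompactExhaustion.choice U
  have hK : ∀ n, ∃ χ, IsTestFunction U χ ∧ (∀ᶠ x in 𝓝ˢ (Subtype.val '' K n), χ x = 1) ∧
      ∀ x, χ x ∈ Icc (0 : ℝ) 1 := fun n =>
    exists_cutoff ((K.isCompact n).image continuous_subtype_val) hU (by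
      rintro _ ⟨x, -, rfl⟩; exact x.2)
  choose φ h1 h2 h3 using hK
  refine ⟨φ, h1, h3, fun x => ?_⟩
  by_cases hx : x ∈ U
  · obtain ⟨N, hN⟩ := K.exists_mem ⟨x, hx⟩
    refine tendsto_const_nhds.congr' ?_
    filter_upwards [eventually_ge_atTop N] with n hn
    rw [indicator_of_mem hx, (h2 n).self_of_nhdsSet x ⟨⟨x, hx⟩, K.subset hn hN, rfl⟩]
    rfl
  · rw [indicator_of_notMem hx]
    simp only [(h1 _).eq_zero hx]
    exact tendsto_const_nhds

theorem abs_le_one_of_mem_Icc {t : ℝ} (h : t ∈ Icc (0 : ℝ) 1) : |t| ≤ 1 :=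
  abs_le.2 ⟨by linarith [h.1], h.2⟩

theorem IsTestFunction.measurable_restrict {O Ω : Set Plane} {φ : Plane → ℝ}
    (h : IsTestFunction O φ) : Measurable fun x : Ω => φ x :=
  h.smooth.continuous.measurable.comp measurable_subtype_coe

/-- Finite measures on `Ω` are determined by test functions. -/
theorem measure_ext_of_testFunction {Ω : Set Plane} (hΩ : IsOpen Ω) (m₁ m₂ : Measure Ω)
    [IsFiniteMeasure m₁] [IsFiniteMeasure m₂]
    (h : ∀ φ, IsTestFunction Ω φ → ∫ x : Ω, φ x ∂m₁ = ∫ x : Ω, φ x ∂m₂) : m₁ = m₂ := by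
  have hopen : ∀ s : Set Ω, IsOpen s → m₁ s = m₂ s := by
    intro s hs
    have hU : IsOpen (Subtype.val '' s) := hΩ.isOpenMap_subtype_val s hs
    obtain ⟨φ, h1, h2, h3⟩ := exists_seq_testFunction_tendsto_indicator hU
    have hsub : Subtype.val '' s ⊆ Ω := by rintro _ ⟨x, -, rfl⟩; exact x.2
    have hlim : ∀ (m : Measure Ω) [IsFiniteMeasure m],
        Tendsto (fun n => ∫ x : Ω, φ n x ∂m) atTop (𝓝 (m.real s)) := by
      intro m _
      have e : m.real s = ∫ x : Ω, (Subtype.val '' s).indicator 1 (x : Plane) ∂m := by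
        rw [← integral_indicator_one hs.measurableSet]
        refine integral_congr_ae (Eventually.of_forall fun x => ?_)
        by_cases hx : x ∈ s
        · simp [hx]
        · simp [hx]
      rw [e]
      refine tendsto_integral_of_dominated_convergence (fun _ => 1)
        (fun n => (h1 n).measurable_restrict.aestronglyMeasurable) (integrable_const 1)
        (fun n => Eventually.of_forall fun x => abs_le_one_of_mem_Icc (h2 n x))
        (Eventually.of_forall fun x => h3 x)
    have := tendsto_nhds_unique (hlim m₁)
      ((hlim m₂).congr fun n => (h _ ((h1 n).mono hsub)).symm)
    rwa [measureReal_eq_measureReal_iff] at this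
  refine ext_of_generate_finite {s | IsOpen s} (BorelSpace.measurable_eq) isPiSystem_isOpen
    hopen (hopen univ isOpen_univ)

/-- Finite signed measures on `Ω` are determined by test functions. -/
theorem signedMeasure_ext_of_testFunction {Ω : Set Plane} (hΩ : IsOpen Ω) {ν₁ ν₂ : SignedMeasure Ω}
    (h : ∀ φ, IsTestFunction Ω φ →
      signedIntegral ν₁ (fun x : Ω => φ x) = signedIntegral ν₂ (fun x : Ω => φ x)) : ν₁ = ν₂ := by
  -- Equality of signed measures becomes equality of the positive measures ν₁⁺ + ν₂⁻ and ν₂⁺ + ν₁⁻.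
  have key := measure_ext_of_testFunction hΩ
    (ν₁.toJordanDecomposition.posPart + ν₂.toJordanDecomposition.negPart)
    (ν₂.toJordanDecomposition.posPart + ν₁.toJordanDecomposition.negPart) (fun φ hφ => by
      obtain ⟨C, hC, -⟩ := hφ.exists_bound
      have hi : ∀ (m : Measure Ω) [IsFiniteMeasure m], Integrable (fun x : Ω => φ x) m := fun m _ =>
        integrable_of_bounded hφ.measurable_restrict (fun x => hC x) m
      have := h φ hφ
      rw [signedIntegral, signedIntegral, sub_eq_sub_iff_add_eq_add] at this
      rw [integral_add_measure (hi _) (hi _), integral_add_measure (hi _) (hi _), this])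
  rw [eq_jordan_sub ν₁, eq_jordan_sub ν₂, sub_eq_sub_iff_add_eq_add,
    ← Measure.toSignedMeasure_add, ← Measure.toSignedMeasure_add]
  exact Measure.toSignedMeasure_congr key

/-- Integrals of lower semicontinuous step functions are controlled by test functions below
them. -/
theorem integral_step_le_of_testFunction {Ω U : Set Plane} (hΩ : IsOpen Ω) (hU : IsOpen U)
    {β γ : ℝ} (hβ : 0 ≤ β) (hγ : 0 ≤ γ) (m : Measure Ω) [IsFiniteMeasure m] {B : ℝ}
    (h : ∀ φ, IsTestFunction Ω φ → (∀ x, 0 ≤ φ x) →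
      (∀ x, φ x ≤ β + U.indicator (fun _ => γ) x) → ∫ x : Ω, φ x ∂m ≤ B) :
    ∫ x : Ω, (β + U.indicator (fun _ => γ) (x : Plane)) ∂m ≤ B := by
  obtain ⟨φ, h1, h2, h3⟩ := exists_seq_testFunction_tendsto_indicator hΩ
  obtain ⟨ψ, k1, k2, k3⟩ := exists_seq_testFunction_tendsto_indicator (hΩ.inter hU)
  -- With φ_n → 1_Ω and ψ_n → 1_(Ω ∩ U), these functions lie below the step function and converge to
  -- it at every point of Ω. Openness of U enters here, so m may charge its frontier.
  have ht : ∀ n, IsTestFunction Ω fun x => β * φ n x + γ * ψ n x := fun n =>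
    ((h1 n).const_mul β).add (((k1 n).mono inter_subset_left).const_mul γ)
  have hlim : Tendsto (fun n => ∫ x : Ω, (β * φ n x + γ * ψ n x) ∂m) atTop
      (𝓝 (∫ x : Ω, (β + U.indicator (fun _ => γ) (x : Plane)) ∂m)) := by
    refine tendsto_integral_of_dominated_convergence (fun _ => β + γ)
      (fun n => (ht n).measurable_restrict.aestronglyMeasurable) (integrable_const _)
      (fun n => Eventually.of_forall fun x => ?_) (Eventually.of_forall fun x => ?_)
    · have a1 := mul_nonneg hβ (h2 n x).1
      have a2 := mul_nonneg hγ (k2 n x).1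
      have a3 := mul_le_of_le_one_right hβ (h2 n x).2
      have a4 := mul_le_of_le_one_right hγ (k2 n x).2
      rw [Real.norm_eq_abs, abs_of_nonneg (add_nonneg a1 a2)]
      exact add_le_add a3 a4
    · have hl := ((h3 x).const_mul β).add ((k3 x).const_mul γ)
      refine hl.trans (le_of_eq (congrArg 𝓝 ?_))
      rw [indicator_of_mem x.2]
      by_cases hx : (x : Plane) ∈ U
      · rw [indicator_of_mem hx, indicator_of_mem (show (x : Plane) ∈ Ω ∩ U from ⟨x.2, hx⟩)]
        simp
      · rw [indicator_of_notMem hx, indicator_of_notMem fun h => hx h.2]; simp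
  refine le_of_tendsto hlim (Eventually.of_forall fun n => h _ (ht n) (fun x => ?_) fun x => ?_)
  · exact add_nonneg (mul_nonneg hβ (h2 n x).1) (mul_nonneg hγ (k2 n x).1)
  · refine add_le_add (mul_le_of_le_one_right hβ (h2 n x).2) ?_
    by_cases hx : x ∈ U
    · rw [indicator_of_mem hx]; exact mul_le_of_le_one_right hγ (k2 n x).2
    · rw [indicator_of_notMem hx, (k1 n).eq_zero fun h => hx h.2, mul_zero]

/-- The restriction of a test function to `Ω` as a compactly supported function. -/
def IsTestFunction.toCc {Ω : Set Plane} {φ : Plane → ℝ} (h : IsTestFunction Ω φ) :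
    CompactlySupportedContinuousMap Ω ℝ where
  toFun x := φ x
  continuous_toFun := h.smooth.continuous.comp continuous_subtype_val
  hasCompactSupport' := by
    refine HasCompactSupport.intro (K := Subtype.val ⁻¹' tsupport φ) ?_ fun x hx =>
      image_eq_zero_of_notMem_tsupport (f := φ) hx
    rw [IsEmbedding.subtypeVal.isInducing.isCompact_preimage_iff]
    · exact h.compact
    · rw [Subtype.range_val]; exact h.support_subset

/-- The extension by zero of a function on `Ω`. -/
def zeroExtend {Ω : Set Plane} (g : Ω → ℝ) : Plane → ℝ := Function.extend Subtype.val g 0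

theorem IsTestFunction.zeroExtend_eq {Ω : Set Plane} {φ : Plane → ℝ} (h : IsTestFunction Ω φ)
    {g : Ω → ℝ} (hg : ∀ x : Ω, g x = φ x) : zeroExtend g = φ := by
  ext x
  by_cases hx : x ∈ Ω
  · have := Subtype.val_injective.extend_apply g (0 : Plane → ℝ) ⟨x, hx⟩
    rw [hg] at this
    exact this
  · rw [h.eq_zero hx]
    exact Function.extend_apply' _ _ _ (by rintro ⟨y, rfl⟩; exact hx y.2)

/-- A bounded positive linear functional on test functions is a finite measure. -/
theorem exists_measure_of_positive {Ω : Set Plane} (hΩ : IsOpen Ω) (L : (Plane → ℝ) → ℝ)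
    (hadd : ∀ φ ψ, IsTestFunction Ω φ → IsTestFunction Ω ψ → L (fun x => φ x + ψ x) = L φ + L ψ)
    (hmul : ∀ (c : ℝ) φ, IsTestFunction Ω φ → L (fun x => c * φ x) = c * L φ)
    (hpos : ∀ φ, IsTestFunction Ω φ → (∀ x, 0 ≤ φ x) → 0 ≤ L φ) {C : ℝ}
    (hC : ∀ φ, IsTestFunction Ω φ → (∀ x, φ x ∈ Icc (0 : ℝ) 1) → L φ ≤ C) :
    ∃ m : Measure Ω, IsFiniteMeasure m ∧ ∀ φ, IsTestFunction Ω φ → ∫ x : Ω, φ x ∂m = L φ := by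
  have : LocallyCompactSpace Ω := hΩ.locallyCompactSpace
  let D : Submodule ℝ (CompactlySupportedContinuousMap Ω ℝ) :=
    { carrier := {g | ∃ φ, IsTestFunction Ω φ ∧ ∀ x : Ω, g x = φ x}
      add_mem' := by
        rintro g g' ⟨φ, hφ, h⟩ ⟨φ', hφ', h'⟩
        exact ⟨_, hφ.add hφ', fun x => by simp [h, h']⟩
      zero_mem' := ⟨_, IsTestFunction.zero Ω, fun x => rfl⟩
      smul_mem' := by
        rintro c g ⟨φ, hφ, h⟩
        exact ⟨_, hφ.const_mul c, fun x => by simp [h]⟩ }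
  let f : CompactlySupportedContinuousMap Ω ℝ →ₗ.[ℝ] ℝ :=
    { domain := D
      toFun :=
        { toFun := fun g => L (zeroExtend (g : CompactlySupportedContinuousMap Ω ℝ))
          map_add' := by
            rintro ⟨g, φ, hφ, h⟩ ⟨g', φ', hφ', h'⟩
            simp only
            rw [hφ.zeroExtend_eq h, hφ'.zeroExtend_eq h', ← hadd φ φ' hφ hφ',
              (hφ.add hφ').zeroExtend_eq fun x => by simp [h, h']]
          map_smul' := by
            rintro c ⟨g, φ, hφ, h⟩
            simp only [RingHom.id_apply, smul_eq_mul]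
            rw [hφ.zeroExtend_eq h, ← hmul c φ hφ,
              (hφ.const_mul c).zeroExtend_eq fun x => by simp [h]] } }
  let s : PointedCone ℝ (CompactlySupportedContinuousMap Ω ℝ) :=
    { carrier := {g | ∀ x, 0 ≤ g x}
      add_mem' := fun {g g'} h h' x => add_nonneg (h x) (h' x)
      zero_mem' := fun x => le_rfl
      smul_mem' := fun c g h x => mul_nonneg c.2 (h x) }
  -- The M. Riesz theorem extends the functional from test functions to all of C_c(Ω) and keeps it
  -- positive. It needs each g to enter the cone after addition of a test function: M times a cutoff
  -- that is one on the support of g, with |g| ≤ M.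
  obtain ⟨Λ, hΛ, hΛpos⟩ := riesz_extension s f
    (by
      rintro ⟨g, φ, hφ, h⟩ hg
      change 0 ≤ L (zeroExtend g)
      rw [hφ.zeroExtend_eq h]
      refine hpos φ hφ fun x => ?_
      by_cases hx : x ∈ Ω
      · rw [← h ⟨x, hx⟩]; exact hg _
      · rw [hφ.eq_zero hx])
    (by
      intro g
      obtain ⟨χ, hχ, h1, h2⟩ := exists_cutoff
        (g.hasCompactSupport.isCompact.image continuous_subtype_val) hΩ (by
          rintro _ ⟨x, -, rfl⟩; exact x.2)
      obtain ⟨M, hM⟩ := g.continuous.bounded_above_of_compact_support g.hasCompactSupport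
      refine ⟨⟨(hχ.const_mul M).toCc, _, hχ.const_mul M, fun x => rfl⟩, fun x => ?_⟩
      change 0 ≤ M * χ x + g x
      by_cases hx : x ∈ tsupport g
      · rw [h1.self_of_nhdsSet x ⟨x, hx, rfl⟩, mul_one]
        have : |g x| ≤ M := hM x
        linarith [neg_abs_le (g x)]
      · rw [image_eq_zero_of_notMem_tsupport hx, add_zero]
        exact mul_nonneg ((norm_nonneg _).trans (hM x)) (h2 x).1)
  let P : CompactlySupportedContinuousMap Ω ℝ →ₚ[ℝ] ℝ :=
    PositiveLinearMap.mk₀ Λ fun g hg => hΛpos g fun x => hg x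
  have hint : ∀ φ (hφ : IsTestFunction Ω φ), ∫ x : Ω, φ x ∂(RealRMK.rieszMeasure P) = L φ := by
    intro φ hφ
    have e1 := RealRMK.integral_rieszMeasure P hφ.toCc
    have e2 := hΛ ⟨hφ.toCc, φ, hφ, fun x => rfl⟩
    refine (e1.trans e2).trans ?_
    exact congrArg L (hφ.zeroExtend_eq fun x => rfl)
  refine ⟨RealRMK.rieszMeasure P, ⟨?_⟩, hint⟩
  refine lt_of_le_of_lt ?_ (ENNReal.ofReal_lt_top (r := C))
  -- By inner regularity it is enough to bound the measure of compact sets, and each is at most the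
  -- integral of a cutoff, hence at most C.
  rw [isOpen_univ.measure_eq_iSup_isCompact]
  refine iSup_le fun K => iSup_le fun _ => iSup_le fun hK => ?_
  obtain ⟨χ, hχ, h1, h2⟩ := exists_cutoff (hK.image continuous_subtype_val) hΩ (by
    rintro _ ⟨x, -, rfl⟩; exact x.2)
  refine ENNReal.le_ofReal_iff_toReal_le hK.measure_lt_top.ne ?_ |>.2 ?_
  · exact (hpos χ hχ fun x => (h2 x).1).trans (hC χ hχ h2)
  · refine le_trans ?_ (hC χ hχ h2)
    rw [← hint χ hχ, ← Measure.real, ← integral_indicator_one hK.measurableSet]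
    refine integral_mono ((integrable_indicator_iff hK.measurableSet).2
      (integrableOn_const hK.measure_lt_top.ne))
      (hχ.toCc.continuous.integrable_of_hasCompactSupport hχ.toCc.hasCompactSupport) fun x => ?_
    by_cases hx : x ∈ K
    · rw [indicator_of_mem hx, h1.self_of_nhdsSet _ ⟨x, hx, rfl⟩]; rfl
    · rw [indicator_of_notMem hx]; exact (h2 x).1

/-! ### Energies as Hilbert space norms -/

/-- A measurable weight with values in `[b, M]`, where `b > 0`. -/
structure IsWeight (p : Plane → ℝ) (b M : ℝ) : Prop where
  measurable : Measurable p
  pos : 0 < b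
  le : ∀ x, b ≤ p x
  ge : ∀ x, p x ≤ M

namespace IsWeight

variable {p : Plane → ℝ} {b M : ℝ}

theorem apply_pos (hp : IsWeight p b M) (x : Plane) : 0 < p x := hp.pos.trans_le (hp.le x)

/-- The diagonal operator `(u, G) ↦ (u, p^{-1/2} G)`. -/
def coeff (hp : IsWeight p b M) : JetCoeff where
  α := 1
  β := fun x => (√(p x))⁻¹
  w := 0
  measurable_α := measurable_one
  measurable_β := hp.measurable.sqrt.inv
  measurable_w := measurable_zero
  bound := 1 + (√b)⁻¹
  abs_α_le x := by
    simp
  abs_β_le x := by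
    rw [abs_of_nonneg (inv_nonneg.2 (Real.sqrt_nonneg _))]
    have : (√(p x))⁻¹ ≤ (√b)⁻¹ :=
      inv_anti₀ (Real.sqrt_pos.2 hp.pos) (Real.sqrt_le_sqrt (hp.le x))
    linarith
  norm_w_le x := by
    have : 0 ≤ (√b)⁻¹ := inv_nonneg.2 (Real.sqrt_nonneg b)
    simp only [Pi.zero_apply, norm_zero]
    linarith

/-- The operator `(u, G) ↦ (u, p^{-1/2} G)`, which turns the energy into the norm. -/
def op (hp : IsWeight p b M) : JetSpace →L[ℝ] JetSpace := hp.coeff.op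

theorem inner_act (hp : IsWeight p b M) (x : Plane) (z z' : JetValue) :
    inner ℝ (hp.coeff.act x z) (hp.coeff.act x z') =
      inner ℝ z.snd z'.snd / p x + z.fst * z'.fst := by
  change inner ℝ ((hp.coeff.act x z).fst) ((hp.coeff.act x z').fst) +
    inner ℝ ((hp.coeff.act x z).snd) ((hp.coeff.act x z').snd) = _
  simp only [JetCoeff.act_fst, JetCoeff.act_snd, coeff, Pi.zero_apply, Pi.one_apply, smul_zero,
    zero_add, one_mul, real_inner_smul_left, real_inner_smul_right]
  have h : (√(p x))⁻¹ * ((√(p x))⁻¹ * inner ℝ z.snd z'.snd) = inner ℝ z.snd z'.snd / p x := by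
    rw [← mul_assoc, ← mul_inv, Real.mul_self_sqrt (hp.apply_pos x).le, inv_mul_eq_div]
  rw [h, add_comm, show inner ℝ z.fst z'.fst = z'.fst * z.fst from rfl, mul_comm z'.fst]

/-- From p ≤ M follows |G|² ≤ M|G|²/p, so c = max(1, M)^(-1/2) works. Existence in the obstacle
problem and uniqueness of minimizers both rest on this coercivity. -/
theorem exists_lower_bound (hp : IsWeight p b M) : ∃ c > 0, ∀ x, c * ‖x‖ ≤ ‖hp.op x‖ := by
  set R := max 1 M
  have hR : 0 < √R := Real.sqrt_pos.2 (lt_max_of_lt_left one_pos)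
  refine ⟨(√R)⁻¹, inv_pos.2 hR, fun x => ?_⟩
  rw [inv_mul_le_iff₀ hR]
  refine Lp.norm_le_mul_norm_of_ae_le_mul ?_
  filter_upwards [hp.coeff.coeFn_op x] with z hz
  rw [op, hz]
  refine le_of_sq_le_sq ?_ (by positivity)
  rw [mul_pow, Real.sq_sqrt (lt_max_of_lt_left one_pos).le, ← real_inner_self_eq_norm_sq,
    ← real_inner_self_eq_norm_sq, inner_act, real_inner_self_eq_norm_sq,
    real_inner_self_eq_norm_sq, JetValue.norm_sq]
  have h1 : ‖(x z).snd‖ ^ 2 ≤ R * (‖(x z).snd‖ ^ 2 / p z) := by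
    rw [mul_div_assoc', le_div_iff₀ (hp.apply_pos z), mul_comm R]
    exact mul_le_mul_of_nonneg_left ((hp.ge z).trans (le_max_right _ _)) (by positivity)
  have h2 : (x z).fst ^ 2 ≤ R * ((x z).fst * (x z).fst) := by
    rw [← sq]; exact le_mul_of_one_le_left (sq_nonneg _) (le_max_left _ _)
  rw [mul_add]
  linarith

theorem eq_of_op_sub_eq_zero (hp : IsWeight p b M) {x y : JetSpace} (h : ‖hp.op (x - y)‖ ^ 2 ≤ 0) :
    x = y := by
  obtain ⟨c, hc, hle⟩ := hp.exists_lower_bound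
  have h0 : ‖hp.op (x - y)‖ = 0 := by
    have := sq_nonneg ‖hp.op (x - y)‖
    exact pow_eq_zero_iff two_ne_zero |>.1 (le_antisymm h this)
  have h1 := hle (x - y)
  rw [h0] at h1
  have h2 : ‖x - y‖ ≤ 0 := by
    by_contra hlt
    push Not at hlt
    nlinarith
  exact sub_eq_zero.1 (norm_le_zero_iff.1 h2)

end IsWeight

theorem memLp_oneJet {Ω : Set Plane} (hΩ : MeasurableSet Ω) (hfin : volume Ω ≠ ⊤) :
    MemLp (Ω.indicator fun _ => (WithLp.toLp 2 (1, 0) : JetValue)) 2 volume :=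
  memLp_indicator_const 2 hΩ _ (Or.inr hfin)

/-- The pair `(1_Ω, 0)`. -/
def oneJet {Ω : Set Plane} (hΩ : MeasurableSet Ω) (hfin : volume Ω ≠ ⊤) : JetSpace :=
  (memLp_oneJet hΩ hfin).toLp

theorem coeFn_oneJet {Ω : Set Plane} (hΩ : MeasurableSet Ω) (hfin : volume Ω ≠ ⊤) :
    oneJet hΩ hfin =ᵐ[volume] Ω.indicator fun _ => (WithLp.toLp 2 (1, 0) : JetValue) :=
  (memLp_oneJet hΩ hfin).coeFn_toLp

theorem inner_oneJet {Ω : Set Plane} (hΩ : MeasurableSet Ω) (hfin : volume Ω ≠ ⊤) (z : JetSpace) :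
    inner ℝ (oneJet hΩ hfin) z = ∫ y in Ω, (z y).fst := by
  rw [L2.inner_def, ← integral_indicator hΩ]
  refine integral_congr_ae ?_
  filter_upwards [coeFn_oneJet hΩ hfin] with y hy
  rw [hy]
  by_cases h : y ∈ Ω
  · rw [indicator_of_mem h, indicator_of_mem h]
    change inner ℝ (1 : ℝ) (z y).fst + inner ℝ (0 : Plane) (z y).snd = _
    rw [inner_zero_left, add_zero]
    exact mul_one _
  · rw [indicator_of_notMem h, indicator_of_notMem h, inner_zero_left]

theorem integrableOn_fst {Ω : Set Plane} (hfin : volume Ω ≠ ⊤) (z : JetSpace) :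
    IntegrableOn (fun y => (z y).fst) Ω volume := by
  have : IsFiniteMeasure (volume.restrict Ω) := ⟨by simpa using hfin.lt_top⟩
  exact ((memLp_fst z).restrict Ω).integrable (by norm_num)

theorem inner_oneJet_op {p : Plane → ℝ} {b M : ℝ} (hp : IsWeight p b M) {Ω : Set Plane}
    (hΩ : MeasurableSet Ω) (hfin : volume Ω ≠ ⊤) (z : JetSpace) :
    inner ℝ (oneJet hΩ hfin) (hp.op z) = inner ℝ (oneJet hΩ hfin) z := by
  rw [inner_oneJet, inner_oneJet]
  refine integral_congr_ae (ae_restrict_of_ae ?_)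
  filter_upwards [hp.coeff.coeFn_op z] with y hy
  rw [IsWeight.op, hy, JetCoeff.act_fst]
  exact one_mul _

theorem inner_eq_setIntegral {Ω : Set Plane} (x y : JetSpace)
    (h : ∀ᵐ z, z ∉ Ω → x z = 0) : inner ℝ x y = ∫ z in Ω, (inner ℝ (x z) (y z) : ℝ) := by
  rw [L2.inner_def]
  refine (setIntegral_eq_integral_of_ae_compl_eq_zero ?_).symm
  filter_upwards [h] with z hz hzΩ
  rw [hz hzΩ, inner_zero_left]

theorem op_eq_zero_off {p : Plane → ℝ} {b M : ℝ} (hp : IsWeight p b M) {Ω : Set Plane}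
    (hΩ : MeasurableSet Ω) {x : JetSpace} (hx : x ∈ zeroTraceJets Ω) :
    ∀ᵐ z, z ∉ Ω → hp.op x z = 0 := by
  filter_upwards [ae_eq_zero_of_mem_zeroTraceJets hΩ hx, hp.coeff.coeFn_op x] with z h1 h2 hz
  rw [IsWeight.op, h2, h1 hz]
  exact JetValue.ext (by simp) (by simp)

section Energy

variable {Ω : Set Plane} {p : Plane → ℝ} {b M : ℝ} {x : JetSpace} {u : Plane → ℝ}

theorem weakGradient_eq_snd (hΩ : IsOpen Ω) (hx : x ∈ zeroTraceJets Ω)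
    (hu : ∀ᵐ z ∂volume.restrict Ω, (x z).fst = u z) :
    ∀ᵐ z ∂volume.restrict Ω, weakGradient Ω u z = (x z).snd :=
  weakGradient_ae_eq hΩ (isWeakGradient_of_mem hx hu)

/-- The added constant contributes ∫ ∇φ, which is zero for a test function. -/
theorem isWeakGradient_add_one {G : Plane → Plane}
    (hu : MemLp u 2 (volume.restrict Ω)) (h : IsWeakGradient Ω u G) :
    IsWeakGradient Ω (fun z => u z + 1) G := by
  refine ⟨h.memLp, fun φ hφ => ?_⟩
  rw [← h.integral_eq φ hφ]
  have hd2 : MemLp (∇ φ) 2 (volume.restrict Ω) :=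
    (hφ.smooth.continuous_gradient.memLp_of_hasCompactSupport hφ.compact.gradient).restrict Ω
  have i1 : Integrable (fun y => u y • ∇ φ y) (volume.restrict Ω) :=
    memLp_one_iff_integrable.1 (hd2.smul hu)
  have i2 : Integrable (fun y => ∇ φ y) volume :=
    hφ.smooth.continuous_gradient.integrable_of_hasCompactSupport hφ.compact.gradient
  have h0 : ∫ y in Ω, ∇ φ y = 0 := by
    rw [setIntegral_eq_integral_of_forall_compl_eq_zero fun y hy => hφ.gradient_eq_zero hy]
    refine ext_inner_left ℝ fun e => ?_
    rw [← integral_inner i2 e, inner_zero_right]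
    have hd : Continuous fun y => fderiv ℝ φ y e :=
      (hφ.smooth.continuous_fderiv (by simp)).clm_apply continuous_const
    have hdc : HasCompactSupport fun y => fderiv ℝ φ y e := by
      refine HasCompactSupport.intro hφ.compact fun y hy => ?_
      rw [← inner_gradient_left, gradient_eq_zero_of_notMem_tsupport hy, inner_zero_left]
    have := integral_mul_fderiv_eq_neg_fderiv_mul_of_integrable (μ := (volume : Measure Plane))
      (f := fun _ => (1 : ℝ)) (g := φ) (v := e) (by simp)
      (by simpa using hd.integrable_of_hasCompactSupport hdc)
      (by simpa using hφ.smooth.continuous.integrable_of_hasCompactSupport hφ.compact)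
      (fun y _ => differentiableAt_const _) (fun y _ => hφ.smooth.differentiable (by simp) y)
    simp only [one_mul, fderiv_fun_const, Pi.zero_apply, zero_apply, zero_mul,
      integral_zero, neg_zero] at this
    rw [← this]
    refine integral_congr_ae (Eventually.of_forall fun y => ?_)
    simp only
    rw [real_inner_comm, inner_gradient_left]
  simp only [add_smul, one_smul]
  rw [integral_add i1 i2.restrict, h0, add_zero]

theorem weakGradient_add_one_eq_snd (hΩ : IsOpen Ω)
    (hx : x ∈ zeroTraceJets Ω) (hu : ∀ᵐ z ∂volume.restrict Ω, (x z).fst = u z) :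
    ∀ᵐ z ∂volume.restrict Ω, weakGradient Ω (fun z => u z + 1) z = (x z).snd :=
  weakGradient_ae_eq hΩ (isWeakGradient_add_one (((memLp_fst x).restrict Ω).ae_eq hu)
    (isWeakGradient_of_mem hx hu))

theorem dirichletEnergy_eq (hΩ : IsOpen Ω) (hp : IsWeight p b M) (hx : x ∈ zeroTraceJets Ω)
    (hu : ∀ᵐ z ∂volume.restrict Ω, (x z).fst = u z) :
    dirichletEnergy Ω p u = ‖hp.op x‖ ^ 2 := by
  rw [← real_inner_self_eq_norm_sq, inner_eq_setIntegral _ _ (op_eq_zero_off hp hΩ.measurableSet hx)]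
  refine integral_congr_ae ?_
  filter_upwards [hu, weakGradient_eq_snd hΩ hx hu, ae_restrict_of_ae (hp.coeff.coeFn_op x)]
    with z h1 h2 h3
  rw [IsWeight.op, h3, hp.inner_act, h2, ← h1, real_inner_self_eq_norm_sq, sq_abs, sq (x z).fst]

theorem op_add_oneJet_eq_zero_off (hΩ : MeasurableSet Ω) (hfin : volume Ω ≠ ⊤)
    (hp : IsWeight p b M) (hx : x ∈ zeroTraceJets Ω) :
    ∀ᵐ z, z ∉ Ω → (hp.op x + oneJet hΩ hfin) z = 0 := by
  filter_upwards [op_eq_zero_off hp hΩ hx, coeFn_oneJet hΩ hfin,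
    Lp.coeFn_add (hp.op x) (oneJet hΩ hfin)] with z h1 h2 h3 hz
  rw [h3, Pi.add_apply, h1 hz, h2, indicator_of_notMem hz, add_zero]

theorem inner_op_add_oneJet_apply (hΩ : MeasurableSet Ω) (hfin : volume Ω ≠ ⊤)
    (hp : IsWeight p b M) : ∀ᵐ z ∂volume.restrict Ω,
      (inner ℝ ((hp.op x + oneJet hΩ hfin) z) ((hp.op x + oneJet hΩ hfin) z) : ℝ) =
        ‖(x z).snd‖ ^ 2 / p z + ((x z).fst + 1) ^ 2 := by
  filter_upwards [ae_restrict_of_ae (hp.coeff.coeFn_op x),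
    ae_restrict_of_ae (coeFn_oneJet hΩ hfin), ae_restrict_mem hΩ,
    ae_restrict_of_ae (Lp.coeFn_add (hp.op x) (oneJet hΩ hfin))] with z h1 h2 h3 h4
  have e : (hp.op x + oneJet hΩ hfin) z =
      hp.coeff.act z (WithLp.toLp 2 ((x z).fst + 1, (x z).snd)) := by
    rw [h4, Pi.add_apply, IsWeight.op, h1, h2, indicator_of_mem h3]
    refine JetValue.ext ?_ ?_
    · rw [WithLp.add_fst, JetCoeff.act_fst, JetCoeff.act_fst]
      change 1 * (x z).fst + 1 = 1 * ((x z).fst + 1)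
      ring
    · rw [WithLp.add_snd, JetCoeff.act_snd, JetCoeff.act_snd]
      simp [IsWeight.coeff]
  rw [e, hp.inner_act, real_inner_self_eq_norm_sq, ← sq]
  rfl

theorem dirichletEnergy_add_one_eq (hΩ : IsOpen Ω) (hfin : volume Ω ≠ ⊤) (hp : IsWeight p b M)
    (hx : x ∈ zeroTraceJets Ω) (hu : ∀ᵐ z ∂volume.restrict Ω, (x z).fst = u z) :
    dirichletEnergy Ω p (fun z => u z + 1) =
      ‖hp.op x + oneJet hΩ.measurableSet hfin‖ ^ 2 := by
  rw [← real_inner_self_eq_norm_sq, inner_eq_setIntegral _ _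
    (op_add_oneJet_eq_zero_off hΩ.measurableSet hfin hp hx)]
  refine integral_congr_ae ?_
  filter_upwards [hu, weakGradient_add_one_eq_snd hΩ hx hu,
    inner_op_add_oneJet_apply (x := x) hΩ.measurableSet hfin hp] with z h1 h2 h3
  rw [h3, h2, ← h1, sq_abs]

/-- Completing the square, v² + 2v = (v + 1)² − 1. Up to the constant |Ω| this is the functional of
the obstacle problem. -/
theorem dualEnergy_eq (hΩ : IsOpen Ω) (hfin : volume Ω ≠ ⊤) (hp : IsWeight p b M)
    (hx : x ∈ zeroTraceJets Ω) (hu : ∀ᵐ z ∂volume.restrict Ω, (x z).fst = u z) :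
    dualEnergy Ω p u =
      ‖hp.op x + oneJet hΩ.measurableSet hfin‖ ^ 2 - volume.real Ω := by
  rw [← real_inner_self_eq_norm_sq, inner_eq_setIntegral _ _
    (op_add_oneJet_eq_zero_off hΩ.measurableSet hfin hp hx)]
  have e : volume.real Ω = ∫ _ in Ω, (1 : ℝ) := by simp
  have : IsFiniteMeasure (volume.restrict Ω) := ⟨by simpa using hfin.lt_top⟩
  rw [e, ← integral_sub (L2.integrable_inner (𝕜 := ℝ) _ _).restrict (integrable_const 1)]
  refine integral_congr_ae ?_
  filter_upwards [hu, weakGradient_eq_snd hΩ hx hu,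
    inner_op_add_oneJet_apply (x := x) hΩ.measurableSet hfin hp] with z h1 h2 h3
  rw [h3, h2, ← h1, sq_abs]
  ring

theorem operatorPairing_eq (hΩ : IsOpen Ω) (hfin : volume Ω ≠ ⊤) (hp : IsWeight p b M)
    (hx : x ∈ zeroTraceJets Ω) (hu : ∀ᵐ z ∂volume.restrict Ω, (x z).fst = u z) (c : ℝ)
    {φ : Plane → ℝ} (hφ : IsTestFunction Ω φ) :
    operatorPairing Ω p u c φ = inner ℝ (hp.op x) (hp.op hφ.jet) +
      c * inner ℝ (oneJet hΩ.measurableSet hfin) hφ.jet := by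
  rw [inner_eq_setIntegral _ _ (op_eq_zero_off hp hΩ.measurableSet hx), inner_oneJet,
    ← integral_const_mul, ← integral_add (L2.integrable_inner (𝕜 := ℝ) _ _).restrict
      ((integrableOn_fst hfin _).const_mul c)]
  refine integral_congr_ae ?_
  filter_upwards [hu, weakGradient_eq_snd hΩ hx hu, ae_restrict_of_ae (hp.coeff.coeFn_op x),
    ae_restrict_of_ae (hp.coeff.coeFn_op hφ.jet), ae_restrict_of_ae hφ.coeFn_jet]
    with z h1 h2 h3 h4 h5
  rw [IsWeight.op, h3, h4, hp.inner_act, h2, ← h1, h5, jetFun_fst, jetFun_snd]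
  ring

theorem operatorPairing_add_one_eq (hΩ : IsOpen Ω)
    (hx : x ∈ zeroTraceJets Ω) (hu : ∀ᵐ z ∂volume.restrict Ω, (x z).fst = u z) (φ : Plane → ℝ) :
    operatorPairing Ω p (fun z => u z + 1) 0 φ = operatorPairing Ω p u 1 φ := by
  refine integral_congr_ae ?_
  filter_upwards [weakGradient_add_one_eq_snd hΩ hx hu, weakGradient_eq_snd hΩ hx hu]
    with z h1 h2
  rw [h1, h2, add_zero]

end Energy

/-! ### The obstacle problem -/

/-- The jets of the members of `H¹₀(Ω)` above the obstacle `-q`. -/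
def obstacleJets (Ω : Set Plane) (q : Plane → ℝ) : Set JetSpace :=
  {x | x ∈ zeroTraceJets Ω ∧ ∀ᵐ z, z ∈ Ω → -q z ≤ (x z).fst}

/-- A subsequence of an L² convergent sequence converges almost everywhere, and the pointwise
inequality passes to the limit. -/
theorem isClosed_obstacleJets (Ω : Set Plane) (q : Plane → ℝ) : IsClosed (obstacleJets Ω q) := by
  refine IsSeqClosed.isClosed fun f x hf hlim => ?_
  refine ⟨(isClosed_zeroTraceJets Ω).mem_of_tendsto hlim
    (Eventually.of_forall fun n => (hf n).1), ?_⟩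
  obtain ⟨ns, -, hns⟩ := (tendstoInMeasure_of_tendsto_Lp hlim).exists_seq_tendsto_ae
  filter_upwards [hns, ae_all_iff.2 fun n => (hf n).2] with z h1 h2 hz
  exact ge_of_tendsto ((JetValue.continuous_fst.tendsto _).comp h1)
    (Eventually.of_forall fun n => h2 (ns n) hz)

theorem convex_obstacleJets (Ω : Set Plane) (q : Plane → ℝ) : Convex ℝ (obstacleJets Ω q) := by
  rintro x ⟨hx, hxq⟩ y ⟨hy, hyq⟩ s t hs ht hst
  refine ⟨(zeroTraceJets Ω).convex hx hy hs ht hst, ?_⟩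
  filter_upwards [hxq, hyq, Lp.coeFn_add (s • x) (t • y), Lp.coeFn_smul s x, Lp.coeFn_smul t y]
    with z h1 h2 h3 h4 h5 hz
  rw [h3, Pi.add_apply, h4, h5, Pi.smul_apply, Pi.smul_apply, WithLp.add_fst, WithLp.smul_fst,
    WithLp.smul_fst, smul_eq_mul, smul_eq_mul]
  have a1 := mul_le_mul_of_nonneg_left (h1 hz) hs
  have a2 := mul_le_mul_of_nonneg_left (h2 hz) ht
  calc -q z = s * -q z + t * -q z := by rw [← add_mul, hst, one_mul]
    _ ≤ _ := add_le_add a1 a2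

section Obstacle

variable {Ω : Set Plane} {p q : Plane → ℝ} {b M : ℝ}

/-- The variational inequality of the obstacle problem. -/
structure IsObstacleSolution (hΩ : IsOpen Ω) (hfin : volume Ω ≠ ⊤) (hp : IsWeight p b M)
    (q : Plane → ℝ) (x : JetSpace) : Prop where
  mem : x ∈ obstacleJets Ω q
  inner_nonneg : ∀ y ∈ obstacleJets Ω q,
    0 ≤ inner ℝ (hp.op x + oneJet hΩ.measurableSet hfin) (hp.op (y - x))

theorem exists_isObstacleSolution (hΩ : IsOpen Ω) (hfin : volume Ω ≠ ⊤) (hp : IsWeight p b M)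
    (hq : ∀ z, 0 ≤ q z) : ∃ x, IsObstacleSolution hΩ hfin hp q x := by
  obtain ⟨c, hc, hle⟩ := hp.exists_lower_bound
  have hne : (obstacleJets Ω q).Nonempty := by
    refine ⟨0, (zeroTraceJets Ω).zero_mem, ?_⟩
    filter_upwards [Lp.coeFn_zero JetValue 2 (volume : Measure Plane)] with z hz _
    rw [hz]
    exact neg_nonpos.2 (hq z)
  obtain ⟨x, hx, hv⟩ := exists_variational_inequality hp.op hc hle
    (oneJet hΩ.measurableSet hfin) hne (isClosed_obstacleJets Ω q) (convex_obstacleJets Ω q)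
  exact ⟨x, hx, hv⟩

namespace IsObstacleSolution

variable {hΩ : IsOpen Ω} {hfin : volume Ω ≠ ⊤} {hp : IsWeight p b M} {x : JetSpace}

/-- Expand the square around x; the cross term is nonnegative by the variational inequality. The
surplus ‖T(y − x)‖² forces uniqueness. -/
theorem norm_sq_add_le (h : IsObstacleSolution hΩ hfin hp q x) {y : JetSpace}
    (hy : y ∈ obstacleJets Ω q) :
    ‖hp.op x + oneJet hΩ.measurableSet hfin‖ ^ 2 + ‖hp.op (y - x)‖ ^ 2 ≤
      ‖hp.op y + oneJet hΩ.measurableSet hfin‖ ^ 2 := by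
  have e : hp.op y + oneJet hΩ.measurableSet hfin =
      (hp.op x + oneJet hΩ.measurableSet hfin) + hp.op (y - x) := by
    rw [map_sub]; abel
  rw [e, norm_add_sq_real (hp.op x + oneJet hΩ.measurableSet hfin)]
  linarith [h.inner_nonneg y hy]

theorem eq_of_norm_sq_le (h : IsObstacleSolution hΩ hfin hp q x) {y : JetSpace}
    (hy : y ∈ obstacleJets Ω q) (hle : ‖hp.op y + oneJet hΩ.measurableSet hfin‖ ^ 2 ≤
      ‖hp.op x + oneJet hΩ.measurableSet hfin‖ ^ 2) : y = x :=
  hp.eq_of_op_sub_eq_zero (by linarith [h.norm_sq_add_le hy])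

/-- The competitor min(x, 0) stays above −q, does not increase ‖T·‖, and does not increase the
linear term ∫ x, so it coincides with x. The one-sided obstacle thus yields the two-sided bound |x|
≤ q. -/
theorem fst_nonpos (h : IsObstacleSolution hΩ hfin hp q x) (hq : ∀ z, 0 ≤ q z) :
    ∀ᵐ z, (x z).fst ≤ 0 := by
  obtain ⟨y, hy, hyx, hW⟩ := exists_min_zero_mem h.mem.1
  have hyK : y ∈ obstacleJets Ω q := by
    refine ⟨hy, ?_⟩
    filter_upwards [hyx, h.mem.2] with z e1 e2 hz
    rw [e1]
    exact le_min (e2 hz) (neg_nonpos.2 (hq z))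
  have e : y = x := by
    refine h.eq_of_norm_sq_le hyK ?_
    have h1 : ‖hp.op y‖ ^ 2 ≤ ‖hp.op x‖ ^ 2 := pow_le_pow_left₀ (norm_nonneg _) (hW hp.coeff rfl) 2
    have h2 : inner ℝ (oneJet hΩ.measurableSet hfin) y ≤
        inner ℝ (oneJet hΩ.measurableSet hfin) x := by
      rw [inner_oneJet, inner_oneJet]
      refine integral_mono_ae (integrableOn_fst hfin y) (integrableOn_fst hfin x)
        (ae_restrict_of_ae ?_)
      filter_upwards [hyx] with z e1
      rw [e1]
      exact min_le_left _ _
    rw [norm_add_sq_real, norm_add_sq_real, real_inner_comm, inner_oneJet_op,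
      real_inner_comm _ (hp.op x), inner_oneJet_op]
    linarith
  filter_upwards [hyx] with z hz
  rw [e] at hz
  rw [hz]
  exact min_le_right _ _

theorem inner_jet_add_nonneg (h : IsObstacleSolution hΩ hfin hp q x) {φ : Plane → ℝ}
    (hφ : IsTestFunction Ω φ) (h0 : ∀ z, 0 ≤ φ z) :
    0 ≤ inner ℝ (hp.op x + oneJet hΩ.measurableSet hfin) (hp.op hφ.jet) := by
  have hy : x + hφ.jet ∈ obstacleJets Ω q := by
    refine ⟨(zeroTraceJets Ω).add_mem h.mem.1 hφ.jet_mem, ?_⟩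
    filter_upwards [h.mem.2, hφ.coeFn_jet, Lp.coeFn_add x hφ.jet] with z h1 h2 h3 hz
    rw [h3, Pi.add_apply, h2, WithLp.add_fst, jetFun_fst]
    linarith [h1 hz, h0 z]
  simpa using h.inner_nonneg _ hy

/-- Since φ ≤ q, the function −φ is admissible. Letting φ approach q bounds ∫ q dm from above,
without ever integrating x against the possibly singular measure m. -/
theorem inner_jet_le (h : IsObstacleSolution hΩ hfin hp q x) {φ : Plane → ℝ}
    (hφ : IsTestFunction Ω φ) (hle : ∀ z, φ z ≤ q z) :
    inner ℝ (hp.op x + oneJet hΩ.measurableSet hfin) (hp.op hφ.jet) ≤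
      -inner ℝ (hp.op x + oneJet hΩ.measurableSet hfin) (hp.op x) := by
  have hy : (-1 : ℝ) • hφ.jet ∈ obstacleJets Ω q := by
    refine ⟨(zeroTraceJets Ω).smul_mem _ hφ.jet_mem, ?_⟩
    filter_upwards [hφ.coeFn_jet, Lp.coeFn_smul (-1 : ℝ) hφ.jet] with z h1 h2 _
    rw [h2, Pi.smul_apply, h1, WithLp.smul_fst, jetFun_fst, smul_eq_mul]
    linarith [hle z]
  have := h.inner_nonneg _ hy
  rw [map_sub, inner_sub_right, map_smul, inner_smul_right] at this
  linarith

theorem inner_eq_operatorPairing (h : IsObstacleSolution hΩ hfin hp q x) {φ : Plane → ℝ}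
    (hφ : IsTestFunction Ω φ) :
    inner ℝ (hp.op x + oneJet hΩ.measurableSet hfin) (hp.op hφ.jet) =
      operatorPairing Ω p (fun z => (x z).fst) 1 φ := by
  rw [operatorPairing_eq hΩ hfin hp h.mem.1 (ae_of_all _ fun _ => rfl) 1 hφ, inner_add_left,
    inner_oneJet_op, one_mul]

/-- The equation of the obstacle problem: the excess is a finite measure. -/
theorem exists_measure (h : IsObstacleSolution hΩ hfin hp q x) {c : ℝ} (hc : 0 < c)
    (hq : ∀ z, c ≤ q z) : ∃ m : Measure Ω, IsFiniteMeasure m ∧ ∀ φ, IsTestFunction Ω φ →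
      ∫ z : Ω, φ z ∂m = operatorPairing Ω p (fun z => (x z).fst) 1 φ := by
  refine exists_measure_of_positive hΩ _ ?_ ?_ ?_
    (C := c⁻¹ * -inner ℝ (hp.op x + oneJet hΩ.measurableSet hfin) (hp.op x)) ?_
  · intro φ ψ hφ hψ
    rw [← h.inner_eq_operatorPairing hφ, ← h.inner_eq_operatorPairing hψ,
      ← h.inner_eq_operatorPairing (hφ.add hψ), hφ.jet_add hψ, map_add, inner_add_right]
  · intro s φ hφ
    rw [← h.inner_eq_operatorPairing hφ, ← h.inner_eq_operatorPairing (hφ.const_mul s),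
      hφ.jet_const_mul, map_smul, inner_smul_right]
  · intro φ hφ h0
    rw [← h.inner_eq_operatorPairing hφ]
    exact h.inner_jet_add_nonneg hφ h0
  · intro φ hφ h01
    -- For 0 ≤ φ ≤ 1 the function cφ lies below c ≤ q; this is the source of the factor c⁻¹ in the
    -- bound on the total mass.
    have := h.inner_jet_le (hφ.const_mul c) fun z =>
      (mul_le_of_le_one_right hc.le (h01 z).2).trans (hq z)
    rw [hφ.jet_const_mul, map_smul, inner_smul_right, h.inner_eq_operatorPairing hφ] at this
    rwa [le_inv_mul_iff₀ hc]

end IsObstacleSolution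

end Obstacle

/-! ### The primal problem and weak duality -/

section Primal

variable {Ω : Set Plane} {p : Plane → ℝ} {b M : ℝ} {x : JetSpace} {u : Plane → ℝ}

/-- Lebesgue measure on `Ω`. -/
abbrev lebesgueOn (Ω : Set Plane) : Measure Ω := Measure.comap Subtype.val volume

theorem isFiniteMeasure_lebesgueOn (hΩ : IsOpen Ω) (hfin : volume Ω ≠ ⊤) :
    IsFiniteMeasure (lebesgueOn Ω) := by
  refine ⟨?_⟩
  rw [lebesgueOn, (MeasurableEmbedding.subtype_coe hΩ.measurableSet).comap_apply, image_univ,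
    Subtype.range_val]
  exact hfin.lt_top

theorem integral_lebesgueOn (hΩ : IsOpen Ω) (hfin : volume Ω ≠ ⊤) {φ : Plane → ℝ}
    (hφ : IsTestFunction Ω φ) :
    ∫ z : Ω, φ z ∂(lebesgueOn Ω) = inner ℝ (oneJet hΩ.measurableSet hfin) hφ.jet := by
  rw [inner_oneJet, integral_subtype_comap hΩ.measurableSet φ]
  refine integral_congr_ae (ae_restrict_of_ae ?_)
  filter_upwards [hφ.coeFn_jet] with z hz
  rw [hz, jetFun_fst]

/-- Admissibility refers to the constant 0 and the energy to the constant 1; the two distributions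
differ by Lebesgue measure on Ω, which is finite. -/
theorem exists_isOperatorMeasure_one (hΩ : IsOpen Ω) (hfin : volume Ω ≠ ⊤) (hp : IsWeight p b M)
    (hx : x ∈ zeroTraceJets Ω) (hu : ∀ᵐ z ∂volume.restrict Ω, (x z).fst = u z)
    (h : ∃ ν, IsOperatorMeasure Ω p u 0 ν) : ∃ ν, IsOperatorMeasure Ω p u 1 ν := by
  have := isFiniteMeasure_lebesgueOn hΩ hfin
  obtain ⟨ν, hν⟩ := h
  refine ⟨(ν.toJordanDecomposition.posPart + lebesgueOn Ω).toSignedMeasure -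
    ν.toJordanDecomposition.negPart.toSignedMeasure, fun φ hφ => ?_⟩
  obtain ⟨C, hC, -⟩ := hφ.exists_bound
  have h0 := hν φ hφ
  rw [operatorPairing_eq hΩ hfin hp hx hu _ hφ, signedIntegral] at h0
  rw [signedIntegral_sub _ _ hφ.measurable_restrict fun z => hC z, integral_add_measure
    (integrable_of_bounded hφ.measurable_restrict (fun z => hC z) _)
    (integrable_of_bounded hφ.measurable_restrict (fun z => hC z) _),
    integral_lebesgueOn hΩ hfin hφ, operatorPairing_eq hΩ hfin hp hx hu _ hφ]
  linarith

theorem exists_isOperatorMeasure_zero (hΩ : IsOpen Ω) (hfin : volume Ω ≠ ⊤) (hp : IsWeight p b M)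
    (hx : x ∈ zeroTraceJets Ω) (hu : ∀ᵐ z ∂volume.restrict Ω, (x z).fst = u z)
    (m : Measure Ω) [IsFiniteMeasure m]
    (hm : ∀ φ, IsTestFunction Ω φ → ∫ z : Ω, φ z ∂m = operatorPairing Ω p u 1 φ) :
    ∃ ν, IsOperatorMeasure Ω p u 0 ν := by
  have := isFiniteMeasure_lebesgueOn hΩ hfin
  refine ⟨m.toSignedMeasure - (lebesgueOn Ω).toSignedMeasure, fun φ hφ => ?_⟩
  obtain ⟨C, hC, -⟩ := hφ.exists_bound
  rw [signedIntegral_sub _ _ hφ.measurable_restrict fun z => hC z, hm φ hφ,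
    integral_lebesgueOn hΩ hfin hφ, operatorPairing_eq hΩ hfin hp hx hu _ hφ,
    operatorPairing_eq hΩ hfin hp hx hu _ hφ]
  ring

theorem operatorMeasure_spec {c : ℝ} (h : ∃ ν, IsOperatorMeasure Ω p u c ν) :
    IsOperatorMeasure Ω p u c (operatorMeasure Ω p u c) := by
  rw [operatorMeasure, dif_pos h]
  exact h.choose_spec

theorem isOperatorMeasure_toSignedMeasure {c : ℝ} (m : Measure Ω) [IsFiniteMeasure m]
    (hm : ∀ φ, IsTestFunction Ω φ → ∫ z : Ω, φ z ∂m = operatorPairing Ω p u c φ) :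
    IsOperatorMeasure Ω p u c m.toSignedMeasure := fun φ hφ => by
  obtain ⟨C, hC, -⟩ := hφ.exists_bound
  have := signedIntegral_sub m 0 hφ.measurable_restrict (fun z => hC z)
  rw [Measure.toSignedMeasure_zero, sub_zero] at this
  rw [this, integral_zero_measure, sub_zero, hm φ hφ]

theorem operatorMeasure_eq (hΩ : IsOpen Ω) {c : ℝ} {ν : SignedMeasure Ω}
    (h : IsOperatorMeasure Ω p u c ν) : operatorMeasure Ω p u c = ν :=
  signedMeasure_ext_of_testFunction hΩ fun φ hφ => by
    rw [← operatorMeasure_spec ⟨ν, h⟩ φ hφ, ← h φ hφ]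

/-- Weak duality. -/
theorem le_primalEnergy (hΩ : IsOpen Ω) (hfin : volume Ω ≠ ⊤) (hp : IsWeight p b M) {lam : ℝ}
    (hlam : 0 < lam) {y : JetSpace} (hy : y ∈ zeroTraceJets Ω)
    (hu : ∀ᵐ z ∂volume.restrict Ω, (y z).fst = u z) (hν : ∃ ν, IsOperatorMeasure Ω p u 0 ν)
    {φ : ℕ → Plane → ℝ} (hφ : ∀ n, IsTestFunction Ω (φ n))
    (hφp : ∀ n z, |φ n z| ≤ p z / (2 * lam)) (hlim : Tendsto (fun n => (hφ n).jet) atTop (𝓝 x)) :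
    ‖hp.op (y - x)‖ ^ 2 - ‖hp.op x‖ ^ 2 - 2 * inner ℝ (oneJet hΩ.measurableSet hfin) x ≤
      primalEnergy Ω p lam u := by
  have hspec := operatorMeasure_spec (exists_isOperatorMeasure_one hΩ hfin hp hy hu hν)
  set ν := operatorMeasure Ω p u 1 with hνdef
  have hqm : Measurable fun z : Ω => p z / (2 * lam) :=
    (hp.measurable.comp measurable_subtype_coe).div_const _
  have hqb : ∀ z : Ω, |p z / (2 * lam)| ≤ M / (2 * lam) := fun z => by
    rw [abs_of_nonneg (div_nonneg (hp.apply_pos z).le (by positivity))]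
    exact div_le_div_of_nonneg_right (hp.ge z) (by positivity)
  -- The bound |φ n| ≤ q holds at every point, so it can be integrated against the total variation
  -- of ν even if ν is singular. The left side is continuous in the jet, and the limit replaces φ n
  -- by x.
  have hle : ∀ n, -(inner ℝ (hp.op y) (hp.op (hφ n).jet) +
      inner ℝ (oneJet hΩ.measurableSet hfin) (hφ n).jet) ≤
      ∫ z : Ω, p z / (2 * lam) ∂ν.totalVariation := by
    intro n
    have e := hspec (φ n) (hφ n)
    rw [operatorPairing_eq hΩ hfin hp hy hu _ (hφ n), one_mul] at e
    rw [e]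
    exact (neg_le_abs _).trans (abs_signedIntegral_le ν (fun z => hφp n z) hqm hqb)
  have hlim1 : Tendsto (fun n => -(inner ℝ (hp.op y) (hp.op (hφ n).jet) +
      inner ℝ (oneJet hΩ.measurableSet hfin) (hφ n).jet)) atTop
      (𝓝 (-(inner ℝ (hp.op y) (hp.op x) + inner ℝ (oneJet hΩ.measurableSet hfin) x))) :=
    ((tendsto_const_nhds.inner ((hp.op.continuous.tendsto x).comp hlim)).add
      (tendsto_const_nhds.inner hlim)).neg
  have hfinal := le_of_tendsto hlim1 (Eventually.of_forall hle)
  have e2 : ∫ z : Ω, p z / lam ∂ν.totalVariation =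
      2 * ∫ z : Ω, p z / (2 * lam) ∂ν.totalVariation := by
    rw [← integral_const_mul]
    refine integral_congr_ae (Eventually.of_forall fun z => ?_)
    simp only
    field_simp
  rw [primalEnergy, ← hνdef, e2, dirichletEnergy_eq hΩ hp hy hu, map_sub, norm_sub_sq_real]
  linarith

end Primal

/-! ### Strong duality and the conclusion -/

/-- Primal and dual problem for a weight whose obstacle is approximated by test functions. -/
theorem exists_primal_dual_minimizer {Ω U : Set Plane} {p : Plane → ℝ} {b c lam : ℝ}
    (hΩ : IsOpen Ω) (hfin : volume Ω ≠ ⊤) (hU : IsOpen U) (hUc : IsCompact (frontier U))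
    (hUΩ : frontier U ⊆ Ω) (hin : HasInwardTranslations U) (hb : 0 < b) (hc : 0 ≤ c)
    (hpU : ∀ z, p z = b + U.indicator (fun _ => c) z) (hlam : 0 < lam) :
    ∃ u : Plane → ℝ,
      IsUniqueMinimizer Ω (primalSet Ω p) (primalEnergy Ω p lam) u ∧
      IsUniqueMinimizer Ω (dualSet Ω p lam) (dualEnergy Ω p) u ∧
      IsMinimizer (obstacleSet Ω p lam) (dirichletEnergy Ω p) (fun x => u x + 1) ∧
      ∃ μ : SignedMeasure Ω, IsOperatorMeasure Ω p (fun x => u x + 1) 0 μ ∧ 0 ≤ μ := by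
  have hp : IsWeight p b (b + c) := by
    refine ⟨?_, hb, fun z => ?_, fun z => ?_⟩
    · rw [funext hpU]
      exact measurable_const.add (measurable_const.indicator hU.measurableSet)
    · rw [hpU]
      exact le_add_of_nonneg_right (indicator_nonneg (fun _ _ => hc) z)
    · rw [hpU]
      gcongr
      exact indicator_le_self' (fun _ _ => hc) z
  have h2l : 0 < 2 * lam := by positivity
  set q : Plane → ℝ := fun z => p z / (2 * lam) with hq
  have hqU : ∀ z, q z = b / (2 * lam) + U.indicator (fun _ => c / (2 * lam)) z := by
    intro z
    rw [hq]
    simp only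
    rw [hpU, add_div]
    by_cases hz : z ∈ U
    · rw [indicator_of_mem hz, indicator_of_mem hz]
    · rw [indicator_of_notMem hz, indicator_of_notMem hz, zero_div]
  have hqb : ∀ z, b / (2 * lam) ≤ q z := fun z => div_le_div_of_nonneg_right (hp.le z) h2l.le
  have hbl : 0 < b / (2 * lam) := div_pos hb h2l
  have hq0 : ∀ z, 0 ≤ q z := fun z => hbl.le.trans (hqb z)
  obtain ⟨x, hx⟩ := exists_isObstacleSolution hΩ hfin hp hq0
  have hxV := hx.mem.1
  set u : Plane → ℝ := fun z => (x z).fst with hu_def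
  have hu : ∀ᵐ z ∂volume.restrict Ω, (x z).fst = u z := ae_of_all _ fun _ => rfl
  have hu10 : MemH10 Ω u := memH10_of_mem hΩ hxV hu
  have hxq : ∀ᵐ z, |(x z).fst| ≤ q z := by
    filter_upwards [hx.fst_nonpos hq0, hx.mem.2,
      ae_eq_zero_of_mem_zeroTraceJets hΩ.measurableSet hxV] with z h1 h2 h3
    by_cases hz : z ∈ Ω
    · rw [abs_of_nonpos h1]
      linarith [h2 hz]
    · rw [h3 hz]
      simpa using hq0 z
  obtain ⟨m, hmfin, hm⟩ := hx.exists_measure hbl hqb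
  have hop1 : IsOperatorMeasure Ω p u 1 m.toSignedMeasure := isOperatorMeasure_toSignedMeasure m hm
  have hop0 := exists_isOperatorMeasure_zero hΩ hfin hp hxV hu m hm
  have hmint : ∫ z : Ω, q z ∂m ≤
      -inner ℝ (hp.op x + oneJet hΩ.measurableSet hfin) (hp.op x) := by
    have := integral_step_le_of_testFunction hΩ hU hbl.le (div_nonneg hc h2l.le) m
      (B := -inner ℝ (hp.op x + oneJet hΩ.measurableSet hfin) (hp.op x)) fun φ hφ _ hle => by
        rw [hm φ hφ, ← hx.inner_eq_operatorPairing hφ]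
        exact hx.inner_jet_le hφ fun z => by rw [hqU]; exact hle z
    simpa only [← hqU] using this
  obtain ⟨φ, hφ, hφb, hφlim⟩ := exists_seq_testFunction_le hΩ hU hUc hUΩ hin hbl.le
    (div_nonneg hc h2l.le) hxV (by simpa only [← hqU] using hxq)
  -- A positive measure is its own total variation, so the energy is 2∫ q dm + ‖Tx‖², and `hmint`
  -- bounds the integral. The result equals the lower bound of weak duality at y = x: there is no
  -- duality gap.
  have hupper : primalEnergy Ω p lam u ≤
      -‖hp.op x‖ ^ 2 - 2 * inner ℝ (oneJet hΩ.measurableSet hfin) x := by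
    have e2 : ∫ z : Ω, p z / lam ∂m = 2 * ∫ z : Ω, q z ∂m := by
      rw [← integral_const_mul]
      refine integral_congr_ae (Eventually.of_forall fun z => ?_)
      simp only [hq]
      field_simp
    rw [primalEnergy, operatorMeasure_eq hΩ hop1, totalVariation_toSignedMeasure, e2,
      dirichletEnergy_eq hΩ hp hxV hu]
    rw [inner_add_left, inner_oneJet_op, real_inner_self_eq_norm_sq] at hmint
    linarith
  -- Weak duality with the matching upper bound for u leaves the surplus ‖T(y − x)‖², which yields
  -- both minimality and uniqueness.
  have hlower : ∀ w ∈ primalSet Ω p, ∃ y ∈ zeroTraceJets Ω,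
      (∀ᵐ z ∂volume.restrict Ω, (y z).fst = w z) ∧
      primalEnergy Ω p lam u + ‖hp.op (y - x)‖ ^ 2 ≤ primalEnergy Ω p lam w := by
    rintro w ⟨hw, hν⟩
    obtain ⟨y, hy, hyw⟩ := hw.exists_jet hΩ.measurableSet
    have hyw' := hyw.mono fun z h => h.1
    refine ⟨y, hy, hyw', ?_⟩
    have := le_primalEnergy hΩ hfin hp hlam hy hyw' hν hφ
      (fun n z => by rw [show p z / (2 * lam) = q z from rfl, hqU]; exact hφb n z) hφlim
    linarith
  -- Only the lower half of the two-sided bound is used: the dual problem has fewer competitors than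
  -- the obstacle problem and contains its solution.
  have hdual : ∀ w ∈ dualSet Ω p lam, ∃ y ∈ obstacleJets Ω q,
      (∀ᵐ z ∂volume.restrict Ω, (y z).fst = w z) := by
    rintro w ⟨hw, hwp⟩
    obtain ⟨y, hy, hyw⟩ := hw.exists_jet hΩ.measurableSet
    refine ⟨y, ⟨hy, (ae_restrict_iff' hΩ.measurableSet).1 ?_⟩, hyw.mono fun z h => h.1⟩
    filter_upwards [hyw, hwp] with z h1 h2
    rw [h1.1]
    exact (abs_le.1 h2).1
  have hudual : u ∈ dualSet Ω p lam := ⟨hu10, ae_restrict_of_ae hxq⟩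
  refine ⟨u, ⟨⟨⟨hu10, hop0⟩, fun w hw => ?_⟩, fun w hw => ?_⟩,
    ⟨⟨hudual, fun w hw => ?_⟩, fun w hw => ?_⟩, ⟨⟨⟨?_, ?_⟩, ?_⟩, ?_⟩, m.toSignedMeasure, ?_,
    Measure.zero_le_toSignedMeasure m⟩
  · obtain ⟨y, -, -, hle⟩ := hlower w hw
    have := sq_nonneg ‖hp.op (y - x)‖
    change primalEnergy Ω p lam u ≤ primalEnergy Ω p lam w
    linarith
  · obtain ⟨y, -, hyw, hle⟩ := hlower w hw.1
    have hmin : primalEnergy Ω p lam w ≤ primalEnergy Ω p lam u := hw.2 ⟨hu10, hop0⟩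
    have e : y = x := hp.eq_of_op_sub_eq_zero (by linarith)
    rw [e] at hyw
    filter_upwards [hyw] with z hz
    exact hz.symm
  · obtain ⟨y, hy, hyw⟩ := hdual w hw
    change dualEnergy Ω p u ≤ dualEnergy Ω p w
    rw [dualEnergy_eq hΩ hfin hp hxV hu, dualEnergy_eq hΩ hfin hp hy.1 hyw]
    have := sq_nonneg ‖hp.op (y - x)‖
    linarith [hx.norm_sq_add_le hy]
  · obtain ⟨y, hy, hyw⟩ := hdual w hw.1
    have hmin : dualEnergy Ω p w ≤ dualEnergy Ω p u := hw.2 hudual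
    rw [dualEnergy_eq hΩ hfin hp hxV hu, dualEnergy_eq hΩ hfin hp hy.1 hyw] at hmin
    have e : y = x := hx.eq_of_norm_sq_le hy (by linarith)
    rw [e] at hyw
    filter_upwards [hyw] with z hz
    exact hz.symm
  · have : IsFiniteMeasure (volume.restrict Ω) := ⟨by simpa using hfin.lt_top⟩
    exact ⟨hu10.memH1.memLp.add (memLp_const 1), _,
      isWeakGradient_add_one hu10.memH1.memLp hu10.memH1.isWeakGradient⟩
  · simpa only [add_sub_cancel_right] using hu10
  · filter_upwards [ae_restrict_of_ae hxq] with z hz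
    rw [add_sub_cancel_right]
    exact (abs_le.1 hz).1
  · rintro f ⟨⟨-, hf10⟩, hfp⟩
    change dirichletEnergy Ω p (fun z => u z + 1) ≤ dirichletEnergy Ω p f
    obtain ⟨y, hy, hyf⟩ := hf10.exists_jet hΩ.measurableSet
    have hyf' := hyf.mono fun z h => h.1
    have hyK : y ∈ obstacleJets Ω q := by
      refine ⟨hy, (ae_restrict_iff' hΩ.measurableSet).1 ?_⟩
      filter_upwards [hyf', hfp] with z h1 h2
      rw [h1]
      exact h2
    have e := dirichletEnergy_add_one_eq hΩ hfin hp hy hyf'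
    simp only [sub_add_cancel] at e
    rw [dirichletEnergy_add_one_eq hΩ hfin hp hxV hu, e]
    have := sq_nonneg ‖hp.op (y - x)‖
    linarith [hx.norm_sq_add_le hyK]
  · intro ψ hψ
    rw [operatorPairing_add_one_eq hΩ hxV hu]
    exact hop1 ψ hψ

end

theorem mainTheorem3 (Ω S₁ : Set Plane) (a lam : ℝ)
    (hΩ : IsOpen Ω) (hΩb : Bornology.IsBounded Ω)
    (hS : IsOpen S₁) (hSs : HasSmoothBoundary S₁) (hSΩ : closure S₁ ⊆ Ω)
    (ha : 0 < a) (ha1 : a ≠ 1) (hlam : 0 < lam) :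
    ∃ u : Plane → ℝ,
      IsUniqueMinimizer Ω (primalSet Ω (stepWeight S₁ a))
        (primalEnergy Ω (stepWeight S₁ a) lam) u ∧
      IsUniqueMinimizer Ω (dualSet Ω (stepWeight S₁ a) lam)
        (dualEnergy Ω (stepWeight S₁ a)) u ∧
      IsMinimizer (obstacleSet Ω (stepWeight S₁ a) lam)
        (dirichletEnergy Ω (stepWeight S₁ a)) (fun x => u x + 1) ∧
      ∃ μ : SignedMeasure Ω,
        IsOperatorMeasure Ω (stepWeight S₁ a) (fun x => u x + 1) 0 μ ∧ 0 ≤ μ := by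
  obtain ⟨U, b, c, hU, hin, hfr, hb, hc, hp⟩ := exists_stepWeight_eq hS hSs ha
  have hUΩ : frontier U ⊆ Ω := hfr.trans (frontier_subset_closure.trans hSΩ)
  exact exists_primal_dual_minimizer hΩ hΩb.measure_lt_top.ne hU
    (Metric.isCompact_of_isClosed_isBounded isClosed_frontier (hΩb.subset hUΩ)) hUΩ hin hb hc hp
    hlam
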